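/- Let $V$ be a $3$-dimensional vector space over $\mathbb{Q}$ with a positive definite symmetric bilinear form $B$, and put $Q(x)=B(x,x)$. A lattice on $V$ is a finitely generated $\mathbb{Z}$-submodule of $V$ that spans $V$ over $\mathbb{Q}$. For a lattice $L$ on $V$, the genus $\mathrm{gen}(L)$ is the set of lattices $M$ on $V$ such that for every prime $q$ some isometry of $V_q=\mathbb{Q}_q\otimes V$ maps $L_q$ onto $M_q$. The class of $M$ is the set of all $\sigma M$ with $\sigma$ an isometry of $V$, and the class number $h(L)$ is the number of classes in $\mathrm{gen}(L)$. Write $O(M)$ for the group of isometries $\sigma$ of $V$ with $\sigma M=M$. For a prime $p$ let $$\Lambda_p(L)=\{x\in L : Q(x+y)\equiv Q(y) \bmod p \text{ for all } y\in L\},$$ and let $h_{n}(N)$ denote the number of classes containing a lattice $M\in\mathrm{gen}(L)$ with $\Lambda_p(M)=N$ and $|O(M)|=n$. Write $\left(\frac{\cdot}{p}\right)$ for the Legendre symbol. Let $p>3$ be a prime, and let $L$ be a lattice on $V$ that is primitive (the $\mathbb{Z}$-module generated by all $B(x,y)$ with $x,y\in L$ is $\mathbb{Z}$), has discriminant (determinant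 of a Gram matrix) $p^2$, and satisfies $L_p\cong\langle 1,1,p^2\rangle$ over $\mathbb{Z}_p$. Put $N=\Lambda_p(L)$. Then $N\cong\langle p^2,p^2,p^2\rangle$, $h(N)=1$, $$h_{16}(N)=1,\qquad h_{12}(N)=\frac{1+\left(\frac{3}{p}\right)}{2},\qquad h_{8}(N)=\frac{1+\left(\frac{2}{p}\right)}{2},$$ and $$h(L)=\frac{1}{48}\left(p^2+p\left(9+\left(\frac{-1}{p}\right)\right)-3\left(\frac{-1}{p}\right)+6\left(\frac{2}{p}\right)-6\left(\frac{-2}{p}\right)+8\left(\frac{3}{p}\right)+32\right).$$ -/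

import Mathlib

open Module
open scoped TensorProduct

noncomputable section

namespace TernaryLattice

/-- `N ≅ A`: the `R`-module `N` has a basis whose Gram matrix with respect to `B` is `A`. -/
def HasGram {R K W : Type*} [CommRing R] [CommRing K] [AddCommGroup W] [Module R W] [Module K W]
    (B : LinearMap.BilinForm K W) (N : Submodule R W) {n : ℕ} (A : Matrix (Fin n) (Fin n) K) : Prop :=
  ∃ b : Basis (Fin n) R N, ∀ i j, B (b i) (b j) = A i j

variable {V : Type*} [AddCommGroup V] [Module ℚ V]

/-- The discriminant of `L` (the determinant of a Gram matrix of `L`) is `d`. -/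
def HasDiscriminant (B : LinearMap.BilinForm ℚ V) (L : Submodule ℤ V) (d : ℚ) : Prop :=
  ∃ (n : ℕ) (A : Matrix (Fin n) (Fin n) ℚ), HasGram B L A ∧ A.det = d

/-- The scale of `L`, the `ℤ`-submodule of `ℚ` generated by all `B x y` with `x, y ∈ L`. -/
def scale (B : LinearMap.BilinForm ℚ V) (L : Submodule ℤ V) : Submodule ℤ ℚ :=
  Submodule.span ℤ {r | ∃ x ∈ L, ∃ y ∈ L, r = B x y}

/-- `L` is primitive if its scale is `ℤ`. -/
def IsPrimitive (B : LinearMap.BilinForm ℚ V) (L : Submodule ℤ V) : Prop :=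
  scale B L = 1

/-- The completion `L_q`, as a `ℤ_q`-submodule of `V_q = ℚ_q ⊗ V`. -/
def completion (q : ℕ) [Fact q.Prime] (L : Submodule ℤ V) : Submodule ℤ_[q] (ℚ_[q] ⊗[ℚ] V) :=
  Submodule.span ℤ_[q] ((fun x : V => (1 : ℚ_[q]) ⊗ₜ[ℚ] x) '' (L : Set V))

/-- The genus of `L`: all lattices `M` on `V` such that at every prime `q` some isometry of the
quadratic space `V_q` maps `L_q` onto `M_q`. -/
def genus (B : LinearMap.BilinForm ℚ V) (L : Submodule ℤ V) : Set (Submodule ℤ V) :=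
  {M | M.IsLattice ℚ ∧ ∀ (q : ℕ) [Fact q.Prime],
    ∃ σ : (B.baseChange ℚ_[q]).IsometryEquiv (B.baseChange ℚ_[q]),
      σ '' (completion q L : Set (ℚ_[q] ⊗[ℚ] V)) = completion q M}

/-- The class of `M`: all images `σ M` under isometries `σ` of `V`. -/
def latticeClass (B : LinearMap.BilinForm ℚ V) (M : Submodule ℤ V) : Set (Submodule ℤ V) :=
  {M' | ∃ σ : B.IsometryEquiv B, σ '' (M : Set V) = M'}

/-- The number of classes of the lattices belonging to a set `S` of lattices. -/
def numClasses (B : LinearMap.BilinForm ℚ V) (S : Set (Submodule ℤ V)) : ℕ :=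
  (latticeClass B '' S).ncard

/-- The class number `h(L)`. -/
def classNumber (B : LinearMap.BilinForm ℚ V) (L : Submodule ℤ V) : ℕ :=
  numClasses B (genus B L)

/-- The order of the isometry group `O(M)`. -/
def isometryOrder (B : LinearMap.BilinForm ℚ V) (M : Submodule ℤ V) : ℕ :=
  Nat.card {σ : B.IsometryEquiv B // σ '' (M : Set V) = M}

/-- `Λ_m(L) = {x ∈ L : Q(x + y) ≡ Q(y) mod m for all y ∈ L}`, where `Q(x) = B(x, x)`. -/
def watson (B : LinearMap.BilinForm ℚ V) (m : ℕ) (L : Submodule ℤ V) : Submodule ℤ V :=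
  AddSubgroup.toIntSubmodule
    { carrier := {x | x ∈ L ∧ ∀ y ∈ L, ∃ k : ℤ, B (x + y) (x + y) - B y y = m * k}
      zero_mem' := ⟨L.zero_mem, fun y _ => ⟨0, by simp⟩⟩
      add_mem' := by
        rintro a b ⟨ha, ha'⟩ ⟨hb, hb'⟩
        refine ⟨L.add_mem ha hb, fun y hy => ?_⟩
        obtain ⟨k, hk⟩ := ha' (b + y) (L.add_mem hb hy)
        obtain ⟨l, hl⟩ := hb' y hy
        refine ⟨k + l, ?_⟩
        rw [add_assoc]
        push_cast
        linear_combination hk + hl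
      neg_mem' := by
        rintro a ⟨ha, ha'⟩
        refine ⟨L.neg_mem ha, fun y hy => ?_⟩
        obtain ⟨k, hk⟩ := ha' (-a + y) (L.add_mem (L.neg_mem ha) hy)
        refine ⟨-k, ?_⟩
        rw [add_neg_cancel_left] at hk
        push_cast
        linear_combination -hk }

/-- `Γ_p^L(N)`: the lattices `M` in the genus of `L` with `Λ_p(M) = N`. -/
def watsonFiber (B : LinearMap.BilinForm ℚ V) (p : ℕ) (L N : Submodule ℤ V) : Set (Submodule ℤ V) :=
  {M | M ∈ genus B L ∧ watson B p M = N}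

/-- `h_n(N)`: the number of classes of lattices in `Γ_p^L(N)` with isometry group of order `n`. -/
def fiberClasses (B : LinearMap.BilinForm ℚ V) (p : ℕ) (L N : Submodule ℤ V) (n : ℕ) : ℕ :=
  numClasses B {M | M ∈ watsonFiber B p L N ∧ isometryOrder B M = n}

end TernaryLattice

end

namespace TernaryLattice

open Matrix

section

/-! ### Reduction of unimodular ternary forms -/

/-! The proof replaces lattices in the genus by points of the sphere `v ⬝ᵥ v = 1` over `𝔽_p`, and
classes by orbits of the finite group `O₃(ℤ)`.

Let `M` be in the genus of `L`. Approximating the third vector of a local basis of type `⟨1, 1, p²⟩`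
and dividing by `p` gives a vector `u` with `B(M, u) ⊆ pℤ` and `Q(u) ≡ 1 mod p`. The lattice `K = M
+ ℤu` is integral of determinant 1, hence isometric to `ℤ³` by reduction theory
(`exists_orthonormal_basis`), and `M` consists of the `x ∈ K` with `B(x, u) ≡ 0 mod p`. So `M` is
the congruence sublattice of the unit vector `v = u mod p`
(`exists_eq_congruenceSublattice_of_mem_genus`). Conversely, all these sublattices of a fixed `K`
lie in one genus, because reflections over `ℤ_p` move `v` to any other unit vector up to sign
(`congruenceSublattice_mem_genus`).

The Watson transform of such an `M` is `pK` (`watson_congruenceSublattice`), which gives the shape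
of `N`; its class number is one because that of `ℤ³` is. Since `pK` is canonical, isometries between
congruence sublattices of `K` come from `O₃(ℤ)`. The sublattice determines `v` up to sign, and `-1 ∈
O₃(ℤ)`. Hence classes are orbits of unit vectors (`latticeClass_congruenceSublattice_eq_iff`), and
`|O(M)|` is twice the order of the stabilizer of `v` (`isometryOrder_congruenceSublattice`).

`O₃(ℤ)` consists of the 48 signed permutations, so `card_stabilizer` reads the stabilizer off the
zero coordinates and the coincidences among squared coordinates. Orders 8, 6, 4 belong to the orbits
of `(1,0,0)`, of `(r,r,r)` with `3r² = 1`, and of `(r,r,0)` with `2r² = 1`; solvability in `r` gives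
the Legendre symbols. The number of all orbits follows from Burnside's formula, the sum of the
stabilizer orders being evaluated by Jacobi sums (`sum_rootWeight_coincidences`). -/

lemma exists_four_mul_add_mul_sq_le (a b : ℤ) (ha : 0 < a) :
    ∃ k : ℤ, 4 * (b + k * a) ^ 2 ≤ a ^ 2 := by
  have h := Int.emod_add_mul_ediv b a
  have h1 := Int.emod_nonneg b ha.ne'
  have h2 := Int.emod_lt_of_pos b ha
  by_cases hc : 2 * (b % a) ≤ a
  · refine ⟨-(b / a), ?_⟩
    rw [show b + -(b / a) * a = b % a by linarith]
    nlinarith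
  · refine ⟨-(b / a) - 1, ?_⟩
    rw [show b + (-(b / a) - 1) * a = b % a - a by linarith]
    nlinarith

/-- A positive definite unimodular ternary form over `ℤ` is equivalent to a sum of three squares. -/
theorem exists_transpose_mul_mul_eq_one (G : Matrix (Fin 3) (Fin 3) ℤ) (hs : G.IsSymm)
    (hpos : ∀ x : Fin 3 → ℤ, x ≠ 0 → 0 < x ⬝ᵥ G *ᵥ x) (hdet : G.det = 1) :
    ∃ U : Matrix (Fin 3) (Fin 3) ℤ, IsUnit U.det ∧ Uᵀ * G * U = 1 := by
  -- Lexicographic descent on the first diagonal entry and then on the leading 2×2 minor, both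
  -- positive integers.
  suffices H : ∀ n m : ℕ, ∀ G : Matrix (Fin 3) (Fin 3) ℤ, G.IsSymm →
      (∀ x : Fin 3 → ℤ, x ≠ 0 → 0 < x ⬝ᵥ G *ᵥ x) → G.det = 1 → (G 0 0).toNat = n →
      (G 0 0 * G 1 1 - G 0 1 ^ 2).toNat = m →
      ∃ U : Matrix (Fin 3) (Fin 3) ℤ, IsUnit U.det ∧ Uᵀ * G * U = 1 from
    H _ _ G hs hpos hdet rfl rfl
  intro n
  induction n using Nat.strong_induction_on with | _ n ihn => ?_
  intro m
  induction m using Nat.strong_induction_on with | _ m ihm => ?_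
  intro G hs hpos hdet hn hm
  have step : ∀ E : Matrix (Fin 3) (Fin 3) ℤ, E.det = -1 →
      ((Eᵀ * G * E).IsSymm → (∀ x : Fin 3 → ℤ, x ≠ 0 → 0 < x ⬝ᵥ (Eᵀ * G * E) *ᵥ x) →
        (Eᵀ * G * E).det = 1 →
        ∃ U : Matrix (Fin 3) (Fin 3) ℤ, IsUnit U.det ∧ Uᵀ * (Eᵀ * G * E) * U = 1) →
      ∃ U : Matrix (Fin 3) (Fin 3) ℤ, IsUnit U.det ∧ Uᵀ * G * U = 1 := by
    intro E hE h
    have h1 : (Eᵀ * G * E).IsSymm := by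
      simp [IsSymm, transpose_mul, hs.eq, Matrix.mul_assoc]
    have h2 : ∀ x : Fin 3 → ℤ, x ≠ 0 → 0 < x ⬝ᵥ (Eᵀ * G * E) *ᵥ x := by
      intro x hx
      have hEx : E *ᵥ x ≠ 0 := by
        intro h0
        exact hx (eq_zero_of_mulVec_eq_zero (by rw [hE]; decide) h0)
      have := hpos _ hEx
      rw [← mulVec_mulVec, ← mulVec_mulVec, dotProduct_mulVec, vecMul_transpose]
      exact this
    have h3 : (Eᵀ * G * E).det = 1 := by
      rw [det_mul, det_mul, det_transpose, hE, hdet]; norm_num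
    obtain ⟨U, hU, hU'⟩ := h h1 h2 h3
    refine ⟨E * U, ?_, ?_⟩
    · rw [det_mul, hE]
      exact (by decide : IsUnit (-1 : ℤ)).mul hU
    · rw [← hU', transpose_mul]
      simp only [Matrix.mul_assoc]
  have e01 : G 1 0 = G 0 1 := hs.apply 0 1
  have e02 : G 2 0 = G 0 2 := hs.apply 0 2
  have e12 : G 2 1 = G 1 2 := hs.apply 1 2
  obtain ⟨a, ha⟩ : ∃ a, G 0 0 = a := ⟨_, rfl⟩
  obtain ⟨b, hb⟩ : ∃ b, G 0 1 = b := ⟨_, rfl⟩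
  obtain ⟨c, hc⟩ : ∃ c, G 0 2 = c := ⟨_, rfl⟩
  obtain ⟨d, hd⟩ : ∃ d, G 1 1 = d := ⟨_, rfl⟩
  obtain ⟨e, he⟩ : ∃ e, G 1 2 = e := ⟨_, rfl⟩
  obtain ⟨f, hf⟩ : ∃ f, G 2 2 = f := ⟨_, rfl⟩
  have hG : G = !![a, b, c; b, d, e; c, e, f] := by
    ext i j; fin_cases i <;> fin_cases j <;> simp [*]
  clear e01 e02 e12 ha hb hc hd he hf
  subst hG
  have hdet' : a * d * f - a * e ^ 2 - b ^ 2 * f + 2 * b * c * e - c ^ 2 * d = 1 := by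
    rw [← hdet, det_fin_three]; simp; ring
  have ha0 : 0 < a := by
    have := hpos ![1, 0, 0] (by intro h; simpa using congrFun h 0)
    simpa [mulVec, dotProduct, Fin.sum_univ_three] using this
  have hm0 : 0 < a * d - b ^ 2 := by
    have := hpos ![-b, a, 0] (by intro h; exact ha0.ne' (by simpa using congrFun h 1))
    simp [mulVec, dotProduct, Fin.sum_univ_three] at this
    refine pos_of_mul_pos_right (a := a) ?_ ha0.le
    linarith
  simp at hn hm
  obtain ⟨k, hk⟩ := exists_four_mul_add_mul_sq_le a b ha0
  obtain ⟨l, hl⟩ := exists_four_mul_add_mul_sq_le (a * d - b ^ 2) (a * e - b * c) hm0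
  -- The left side is the value of the form at `(k, 1, 0)`; if it is smaller than `a`, that vector
  -- becomes the first basis vector.
  by_cases h1 : k ^ 2 * a + 2 * k * b + d < a
  · refine step !![k, 1, 0; 1, 0, 0; 0, 0, 1] (by simp [det_fin_three]) fun hs' hp' hd' => ?_
    refine ihn _ ?_ _ _ hs' hp' hd' rfl rfl
    have hp := hp' ![1, 0, 0] (by intro h; simpa using congrFun h 0)
    simp [mulVec, dotProduct, Fin.sum_univ_three, Matrix.mul_apply] at hp ⊢
    have : (k * a + b) * k + (k * b + d) = k ^ 2 * a + 2 * k * b + d := by ring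
    omega
  -- The left side is the leading 2×2 minor after the second basis vector is replaced by `(0, l,
  -- 1)`; this move keeps `a`.
  by_cases h2 : l ^ 2 * (a * d - b ^ 2) + 2 * l * (a * e - b * c) + (a * f - c ^ 2) < a * d - b ^ 2
  · refine step !![1, 0, 0; 0, l, 1; 0, 1, 0] (by simp [det_fin_three]) fun hs' hp' hd' => ?_
    refine ihm _ ?_ _ hs' hp' hd' ?_ rfl
    · simp [Fin.sum_univ_three, Matrix.mul_apply]
      have : a * ((l * d + e) * l + (l * e + f)) - (b * l + c) ^ 2 =
        l ^ 2 * (a * d - b ^ 2) + 2 * l * (a * e - b * c) + (a * f - c ^ 2) := by ring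
      omega
    · simp [Fin.sum_univ_three, Matrix.mul_apply]
      omega
  push Not at h1 h2
  -- No move lowers the pair any more. Two Hermite-type bounds result: one for the binary form with
  -- entries `a, b, d`, one for the binary form of minors, whose determinant is `a * G.det = a`.
  -- Together they force `a = 1` and minor 1.
  have h3 : 3 * a ^ 2 ≤ 4 * (a * d - b ^ 2) := by nlinarith
  have h4 : 3 * (a * d - b ^ 2) ^ 2 ≤ 4 * a := by
    have hid : (a * d - b ^ 2) * (l ^ 2 * (a * d - b ^ 2) + 2 * l * (a * e - b * c)
        + (a * f - c ^ 2)) = ((a * e - b * c) + l * (a * d - b ^ 2)) ^ 2 + a := by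
      linear_combination a * hdet'
    nlinarith
  have ha1 : a = 1 := by nlinarith
  subst ha1
  have hm1 : d = 1 + b ^ 2 := by nlinarith
  subst hm1
  -- With both leading minors 1, this is Gram–Schmidt over `ℤ`.
  refine ⟨!![1, -b, -c + (e - b * c) * b; 0, 1, -(e - b * c); 0, 0, 1],
    by simp [det_fin_three], ?_⟩
  have hf : f = 1 + c ^ 2 + (e - b * c) ^ 2 := by linear_combination hdet'
  subst hf
  ext i j
  fin_cases i <;> fin_cases j <;> simp [Matrix.mul_apply, Fin.sum_univ_three] <;> ring

end

section

/-! ### Rational numbers and their `q`-adic norms -/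

lemma exists_int_eq_of_norm_le_one (r : ℚ)
    (h : ∀ (q : ℕ) [Fact q.Prime], ‖(r : ℚ_[q])‖ ≤ 1) : ∃ k : ℤ, r = k := by
  by_cases hd : r.den = 1
  · exact ⟨r.num, ((Rat.den_eq_one_iff r).1 hd).symm⟩
  exfalso
  obtain ⟨q, hq, hqd⟩ := Nat.exists_prime_and_dvd hd
  have := Fact.mk hq
  have h1 : ‖((r.den : ℤ) : ℚ_[q])‖ < 1 := (Padic.norm_intCast_lt_one_iff).2 (by exact_mod_cast hqd)
  have h2 : ¬ ‖(r.num : ℚ_[q])‖ < 1 := by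
    rw [Padic.norm_intCast_lt_one_iff]
    intro h3
    have := Nat.dvd_gcd (Int.natCast_dvd.1 h3) hqd
    rw [r.reduced] at this
    exact hq.one_lt.ne' (Nat.dvd_one.1 this)
  have h3 : (r.num : ℚ_[q]) = (r : ℚ_[q]) * ((r.den : ℤ) : ℚ_[q]) := by
    have := Rat.mul_den_eq_num r
    exact_mod_cast this.symm
  apply h2
  rw [h3, norm_mul]
  have := h q
  have h0 := norm_nonneg ((r.den : ℤ) : ℚ_[q])
  nlinarith

lemma eq_one_of_norm_eq_one (r : ℚ) (hr : 0 < r)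
    (h : ∀ (q : ℕ) [Fact q.Prime], ‖(r : ℚ_[q])‖ = 1) : r = 1 := by
  obtain ⟨k, hk⟩ := exists_int_eq_of_norm_le_one r fun q _ => (h q).le
  obtain ⟨l, hl⟩ := exists_int_eq_of_norm_le_one r⁻¹ fun q _ => by
    rw [Rat.cast_inv, norm_inv, h q, inv_one]
  have hkl : k * l = 1 := by
    have : (k : ℚ) * l = 1 := by rw [← hk, ← hl, mul_inv_cancel₀ hr.ne']
    exact_mod_cast this
  have hk0 : 0 < k := by rw [hk] at hr; exact_mod_cast hr
  have : k = 1 := Int.eq_one_or_neg_one_of_mul_eq_one hkl |>.resolve_right (by omega)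
  rw [hk, this, Int.cast_one]

/-! ### Gram matrices -/

/-- The Gram matrix of a family of vectors. -/
def gram {ι K W : Type*} [CommRing K] [AddCommGroup W] [Module K W]
    (B : LinearMap.BilinForm K W) (b : ι → W) : Matrix ι ι K :=
  Matrix.of fun i j => B (b i) (b j)

lemma gram_apply {ι K W : Type*} [CommRing K] [AddCommGroup W] [Module K W]
    (B : LinearMap.BilinForm K W) (b : ι → W) (i j : ι) : gram B b i j = B (b i) (b j) := rfl

lemma gram_of_eq_sum {ι K W : Type*} [Fintype ι] [CommRing K] [AddCommGroup W] [Module K W]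
    (B : LinearMap.BilinForm K W) {b c : ι → W} {T : Matrix ι ι K}
    (h : ∀ j, b j = ∑ i, T i j • c i) : gram B b = Tᵀ * gram B c * T := by
  ext i j
  simp only [gram_apply, h, map_sum, LinearMap.sum_apply, map_smul, LinearMap.smul_apply,
    smul_eq_mul, Matrix.mul_apply, transpose_apply, Finset.sum_mul]
  refine Finset.sum_congr rfl fun k _ => ?_
  rw [Finset.mul_sum]
  refine Finset.sum_congr rfl fun l _ => ?_
  ring

variable {V : Type*} [AddCommGroup V] [Module ℚ V]

lemma exists_basis_span_eq (hV : finrank ℚ V = 3) (M : Submodule ℤ V) (hM : M.IsLattice ℚ) :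
    ∃ b : Basis (Fin 3) ℚ V, Submodule.span ℤ (Set.range b) = M := by
  let b₀ := Module.Free.chooseBasis ℤ M
  let b₁ := b₀.extendOfIsLattice ℚ
  have hc : Fintype.card (Module.Free.ChooseBasisIndex ℤ M) = 3 := by
    rw [← Module.finrank_eq_card_basis b₁, hV]
  let e := Fintype.equivFinOfCardEq hc
  refine ⟨b₁.reindex e, ?_⟩
  rw [Basis.range_reindex]
  have : (b₁ : _ → V) = M.subtype ∘ b₀ := by
    ext k; simp [b₁]
  rw [this, Set.range_comp, ← Submodule.map_span, b₀.span_eq, Submodule.map_top,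
    Submodule.range_subtype]

lemma isLattice_span (b : Basis (Fin 3) ℚ V) :
    (Submodule.span ℤ (Set.range b)).IsLattice ℚ where
  fg := Submodule.fg_span (Set.finite_range b)
  span_eq_top := by
    rw [Submodule.span_span_of_tower, b.span_eq]

lemma completion_span (q : ℕ) [Fact q.Prime] (b : Basis (Fin 3) ℚ V) :
    completion q (Submodule.span ℤ (Set.range b)) =
      Submodule.span ℤ_[q] (Set.range (b.baseChange ℚ_[q])) := by
  apply le_antisymm
  · refine Submodule.span_le.2 ?_
    rintro _ ⟨x, hx, rfl⟩
    obtain ⟨a, rfl⟩ := (Submodule.mem_span_range_iff_exists_fun ℤ).1 hx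
    simp only [TensorProduct.tmul_sum, SetLike.mem_coe]
    refine Submodule.sum_mem _ fun i _ => ?_
    rw [TensorProduct.tmul_smul]
    have hi : (1 : ℚ_[q]) ⊗ₜ[ℚ] b i ∈ Submodule.span ℤ_[q] (Set.range (b.baseChange ℚ_[q])) :=
      Submodule.subset_span ⟨i, by simp⟩
    exact zsmul_mem hi _
  · refine Submodule.span_mono ?_
    rintro _ ⟨i, rfl⟩
    exact ⟨b i, Submodule.subset_span (Set.mem_range_self i), by simp⟩

lemma gram_baseChange (q : ℕ) [Fact q.Prime] (B : LinearMap.BilinForm ℚ V)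
    (b : Basis (Fin 3) ℚ V) :
    gram (B.baseChange ℚ_[q]) (b.baseChange ℚ_[q]) =
      (gram B b).map (algebraMap ℚ ℚ_[q]) := by
  ext i j
  simp [gram_apply, LinearMap.BilinForm.baseChange_tmul, Algebra.smul_def]

lemma exists_matrix_of_subset (q : ℕ) [Fact q.Prime] {W : Type*} [AddCommGroup W]
    [Module ℚ_[q] W] [Module ℤ_[q] W] [IsScalarTower ℤ_[q] ℚ_[q] W] (b c : Fin 3 → W)
    (h : ∀ j, b j ∈ Submodule.span ℤ_[q] (Set.range c)) :
    ∃ T : Matrix (Fin 3) (Fin 3) ℤ_[q],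
      ∀ j, b j = ∑ i, (T.map (algebraMap ℤ_[q] ℚ_[q])) i j • c i := by
  choose a ha using fun j => (Submodule.mem_span_range_iff_exists_fun ℤ_[q]).1 (h j)
  refine ⟨Matrix.of fun i j => a j i, fun j => ?_⟩
  rw [← ha j]
  refine Finset.sum_congr rfl fun i _ => ?_
  rw [Matrix.map_apply, Matrix.of_apply, algebraMap_smul]

lemma image_symm_eq {R W : Type*} [CommRing R] [AddCommGroup W] [Module R W]
    {B : LinearMap.BilinForm R W} (σ : B.IsometryEquiv B) {S T : Set W} (h : σ '' S = T) :
    σ.symm '' T = S := by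
  rw [← h, Set.image_image]
  convert Set.image_id S using 1
  exact Set.image_congr fun x _ => σ.toLinearEquiv.symm_apply_apply x

/-- Only the integral coordinate matrix of the image basis is kept. Using the inverse isometry as
well gives the reverse relation, so invertibility of `T` is never needed. -/
lemma exists_gram_eq_of_image_eq (q : ℕ) [Fact q.Prime] (B : LinearMap.BilinForm ℚ V)
    (b c : Basis (Fin 3) ℚ V)
    (σ : (B.baseChange ℚ_[q]).IsometryEquiv (B.baseChange ℚ_[q]))
    (hσ : σ '' (completion q (Submodule.span ℤ (Set.range b)) : Set (ℚ_[q] ⊗[ℚ] V)) =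
      completion q (Submodule.span ℤ (Set.range c))) :
    ∃ T : Matrix (Fin 3) (Fin 3) ℤ_[q],
      (gram B b).map (algebraMap ℚ ℚ_[q]) = (T.map (algebraMap ℤ_[q] ℚ_[q]))ᵀ *
        (gram B c).map (algebraMap ℚ ℚ_[q]) * T.map (algebraMap ℤ_[q] ℚ_[q]) := by
  rw [completion_span, completion_span] at hσ
  obtain ⟨T, hT⟩ := exists_matrix_of_subset q (fun j => σ (b.baseChange ℚ_[q] j))
    (c.baseChange ℚ_[q]) fun j => by
      rw [← SetLike.mem_coe, ← hσ]
      exact ⟨_, Submodule.subset_span ⟨j, rfl⟩, rfl⟩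
  refine ⟨T, ?_⟩
  rw [← gram_baseChange, ← gram_baseChange, ← gram_of_eq_sum _ hT]
  ext i j
  simp [gram_apply, LinearMap.BilinForm.IsometryEquiv.map_app]

lemma norm_algebraMap_le_one (q : ℕ) [Fact q.Prime] (x : ℤ_[q]) :
    ‖algebraMap ℤ_[q] ℚ_[q] x‖ ≤ 1 := x.2

lemma norm_det_le_of_gram_eq (q : ℕ) [Fact q.Prime] {G H : Matrix (Fin 3) (Fin 3) ℚ}
    {T : Matrix (Fin 3) (Fin 3) ℤ_[q]}
    (h : G.map (algebraMap ℚ ℚ_[q]) = (T.map (algebraMap ℤ_[q] ℚ_[q]))ᵀ *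
        H.map (algebraMap ℚ ℚ_[q]) * T.map (algebraMap ℤ_[q] ℚ_[q])) :
    ‖(G.det : ℚ_[q])‖ ≤ ‖(H.det : ℚ_[q])‖ := by
  have := congrArg Matrix.det h
  rw [det_mul, det_mul, det_transpose, ← RingHom.mapMatrix_apply, ← RingHom.mapMatrix_apply,
    ← RingHom.mapMatrix_apply, ← RingHom.map_det, ← RingHom.map_det, ← RingHom.map_det] at this
  simp only [eq_ratCast] at this
  rw [this, norm_mul, norm_mul]
  have h1 := norm_algebraMap_le_one q T.det
  have h2 := norm_nonneg (algebraMap ℤ_[q] ℚ_[q] T.det)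
  have h3 := norm_nonneg (H.det : ℚ_[q])
  calc _ ≤ 1 * ‖(H.det : ℚ_[q])‖ * 1 := by gcongr
    _ = _ := by ring

/-- At each `q` either determinant is the other times the square of a `q`-adic integer, so their
quotient has norm 1 everywhere; being positive, it is 1. -/
theorem det_gram_eq_of_mem_genus (B : LinearMap.BilinForm ℚ V) (b c : Basis (Fin 3) ℚ V)
    (hb : 0 < (gram B b).det) (hc : 0 < (gram B c).det)
    (h : Submodule.span ℤ (Set.range c) ∈ genus B (Submodule.span ℤ (Set.range b))) :
    (gram B c).det = (gram B b).det := by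
  have key : (gram B c).det / (gram B b).det = 1 := by
    refine eq_one_of_norm_eq_one _ (div_pos hc hb) fun q _ => ?_
    obtain ⟨σ, hσ⟩ := h.2 q
    obtain ⟨T, hT⟩ := exists_gram_eq_of_image_eq q B b c σ hσ
    obtain ⟨S, hS⟩ := exists_gram_eq_of_image_eq q B c b σ.symm (image_symm_eq σ hσ)
    have := le_antisymm (norm_det_le_of_gram_eq q hT) (norm_det_le_of_gram_eq q hS)
    rw [Rat.cast_div, norm_div, this, div_self]
    exact norm_ne_zero_iff.2 (by exact_mod_cast hc.ne')
  rwa [div_eq_one_iff_eq hb.ne'] at key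

/-- Divisibility of a Gram matrix by `s` can be tested at each prime, where `Sᵀ G S` inherits it
from `G`. It is used with `s = 1` for integrality and with a square for scaled lattices. -/
theorem gram_mem_of_mem_genus (B : LinearMap.BilinForm ℚ V) (b c : Basis (Fin 3) ℚ V)
    (s : ℚ) (hs : s ≠ 0) (hb : ∀ i j, ∃ k : ℤ, gram B b i j = s * k)
    (h : Submodule.span ℤ (Set.range c) ∈ genus B (Submodule.span ℤ (Set.range b))) (i j : Fin 3) :
    ∃ k : ℤ, gram B c i j = s * k := by
  obtain ⟨k, hk⟩ := exists_int_eq_of_norm_le_one (gram B c i j / s) fun q _ => by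
    obtain ⟨σ, hσ⟩ := h.2 q
    obtain ⟨S, hS⟩ := exists_gram_eq_of_image_eq q B c b σ.symm (image_symm_eq σ hσ)
    choose k hk using hb
    have h0 : (s : ℚ_[q]) ≠ 0 := by exact_mod_cast hs
    have := congrFun (congrFun hS i) j
    have h1 : ((gram B c i j / s : ℚ) : ℚ_[q]) =
        algebraMap ℤ_[q] ℚ_[q] (∑ l, (∑ m, S m i * k m l) * S l j) := by
      rw [Rat.cast_div, div_eq_iff h0]
      simp only [Matrix.mul_apply, Matrix.map_apply, transpose_apply, hk, eq_ratCast] at this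
      rw [this]
      simp only [map_sum, map_mul, Finset.sum_mul]
      refine Finset.sum_congr rfl fun l _ => Finset.sum_congr rfl fun m _ => ?_
      push_cast
      simp only [map_intCast]
      ring
    rw [h1]
    exact norm_algebraMap_le_one q _
  exact ⟨k, by rw [← hk]; field_simp⟩

end

section

variable {V : Type*} [AddCommGroup V] [Module ℚ V]

/-! ### Orthonormal bases of unimodular lattices -/

lemma apply_sum_sum_eq_dotProduct {ι K W : Type*} [Fintype ι] [CommRing K] [AddCommGroup W] [Module K W]
    (B : LinearMap.BilinForm K W) (b : ι → W) (x y : ι → K) :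
    B (∑ i, x i • b i) (∑ i, y i • b i) = x ⬝ᵥ gram B b *ᵥ y := by
  simp only [map_sum, LinearMap.sum_apply, map_smul, LinearMap.smul_apply, smul_eq_mul,
    dotProduct, mulVec, gram_apply, Finset.mul_sum]
  rw [Finset.sum_comm]
  refine Finset.sum_congr rfl fun i _ => Finset.sum_congr rfl fun j _ => ?_
  ring

lemma apply_sum_sum_of_gram_eq_one {ι K W : Type*} [Fintype ι] [DecidableEq ι] [CommRing K]
    [AddCommGroup W] [Module K W] {B : LinearMap.BilinForm K W} {b : ι → W} (h : gram B b = 1)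
    (x y : ι → K) : B (∑ i, x i • b i) (∑ i, y i • b i) = x ⬝ᵥ y := by
  rw [apply_sum_sum_eq_dotProduct, h, one_mulVec]

lemma linearIndependent_of_gram_eq_one {ι K W : Type*} [Fintype ι] [DecidableEq ι] [Field K]
    [AddCommGroup W] [Module K W] {B : LinearMap.BilinForm K W} {b : ι → W} (h : gram B b = 1) :
    LinearIndependent K b := by
  rw [Fintype.linearIndependent_iff]
  intro g hg i
  have := apply_sum_sum_of_gram_eq_one h g (Pi.single i 1)
  rw [hg] at this
  simpa using this.symm

/-- A rational change of basis multiplies the Gram determinant by a square. -/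
lemma det_gram_pos (B : LinearMap.BilinForm ℚ V) (b c : Basis (Fin 3) ℚ V)
    (hb : 0 < (gram B b).det) : 0 < (gram B c).det := by
  have key : ∀ b c : Basis (Fin 3) ℚ V, ∃ t : ℚ, (gram B b).det = t ^ 2 * (gram B c).det := by
    intro b c
    have := gram_of_eq_sum B (b := b) (c := c) (T := c.toMatrix b) fun j =>
      (c.sum_toMatrix_smul_self b j).symm
    refine ⟨(c.toMatrix b).det, ?_⟩
    rw [this, det_mul, det_mul, det_transpose]; ring
  obtain ⟨t, ht⟩ := key b c
  by_contra hc
  push Not at hc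
  nlinarith [sq_nonneg t, mul_nonneg (sq_nonneg t) (neg_nonneg.2 hc)]

/-- This is the class number one property of `ℤ³`: the reducing matrix `U` is invertible over `ℤ`,
so the new basis spans the same lattice. -/
theorem exists_orthonormal_basis (B : LinearMap.BilinForm ℚ V) (hsymm : B.IsSymm)
    (hpos : ∀ x : V, x ≠ 0 → 0 < B x x) (b : Basis (Fin 3) ℚ V)
    (hint : ∀ i j, ∃ k : ℤ, gram B b i j = k) (hdet : (gram B b).det = 1) :
    ∃ f : Basis (Fin 3) ℚ V, gram B f = 1 ∧
      Submodule.span ℤ (Set.range f) = Submodule.span ℤ (Set.range b) := by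
  choose k hk using hint
  let G : Matrix (Fin 3) (Fin 3) ℤ := Matrix.of k
  have hG : G.map (Int.castRingHom ℚ) = gram B b := by
    ext i j; simp [G, hk]
  have hsym : G.IsSymm := by
    ext i j
    have : (k j i : ℚ) = k i j := by
      rw [← hk, ← hk, gram_apply, gram_apply, hsymm.eq]
    simpa [G] using this
  have hposG : ∀ x : Fin 3 → ℤ, x ≠ 0 → 0 < x ⬝ᵥ G *ᵥ x := by
    intro x hx
    have h1 := apply_sum_sum_eq_dotProduct B b (fun i => (x i : ℚ)) (fun i => (x i : ℚ))
    have h2 : (∑ i, (x i : ℚ) • b i) ≠ 0 := by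
      intro h0
      apply hx
      ext i
      have := Fintype.linearIndependent_iff.1 b.linearIndependent _ h0 i
      exact_mod_cast this
    have h3 := hpos _ h2
    rw [h1, ← hG] at h3
    simp only [dotProduct, mulVec, Matrix.map_apply, eq_intCast] at h3 ⊢
    exact_mod_cast h3
  have hdetG : G.det = 1 := by
    have : ((G.det : ℤ) : ℚ) = 1 := by
      rw [← hdet, ← hG, ← eq_intCast (Int.castRingHom ℚ), RingHom.map_det, RingHom.mapMatrix_apply]
    exact_mod_cast this
  obtain ⟨U, hU, hUG⟩ := exists_transpose_mul_mul_eq_one G hsym hposG hdetG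
  have hU' := Matrix.mul_nonsing_inv U hU
  let f₀ : Fin 3 → V := fun j => ∑ i, (U.map (Int.castRingHom ℚ)) i j • b i
  have hf₀ : gram B f₀ = 1 := by
    rw [gram_of_eq_sum B (b := f₀) (c := b) (T := U.map (Int.castRingHom ℚ)) fun _ => rfl, ← hG]
    rw [← Matrix.transpose_map, ← Matrix.map_mul, ← Matrix.map_mul, hUG,
      Matrix.map_one _ (map_zero _) (map_one _)]
  let f := basisOfLinearIndependentOfCardEqFinrank (linearIndependent_of_gram_eq_one hf₀)
    (Module.finrank_eq_card_basis b).symm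
  have hf : (f : Fin 3 → V) = f₀ := coe_basisOfLinearIndependentOfCardEqFinrank _ _
  refine ⟨f, by rw [hf, hf₀], ?_⟩
  rw [hf]
  apply le_antisymm
  · refine Submodule.span_le.2 ?_
    rintro _ ⟨j, rfl⟩
    refine Submodule.sum_mem _ fun i _ => ?_
    simp only [map_apply, eq_intCast, Int.cast_smul_eq_zsmul]
    exact Submodule.smul_mem _ _ (Submodule.subset_span (Set.mem_range_self i))
  · refine Submodule.span_le.2 ?_
    rintro _ ⟨j, rfl⟩
    have : b j = ∑ i, (U⁻¹) i j • f₀ i := by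
      have h1 : ∀ l, (U⁻¹ l j) • f₀ l = ∑ i, (U i l * U⁻¹ l j) • b i := by
        intro l
        simp only [f₀, Finset.smul_sum, map_apply, eq_intCast, Int.cast_smul_eq_zsmul, smul_smul]
        exact Finset.sum_congr rfl fun i _ => by rw [mul_comm]
      rw [Finset.sum_congr rfl fun l _ => h1 l, Finset.sum_comm]
      simp only [← Finset.sum_smul, ← Matrix.mul_apply, hU', Matrix.one_apply, ite_smul,
        one_smul, zero_smul, Finset.sum_ite_eq', Finset.mem_univ, if_true]
    rw [SetLike.mem_coe, this]
    exact Submodule.sum_mem _ fun i _ =>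
      Submodule.smul_mem _ _ (Submodule.subset_span (Set.mem_range_self i))

/-! ### The sublattices cut out by a congruence modulo `p` -/

/-- The vectors of `ℤf₀ + ℤf₁ + ℤf₂` whose coordinates are orthogonal to `v` modulo `p`. -/
def congruenceSublattice {p : ℕ} (f : Basis (Fin 3) ℚ V) (v : Fin 3 → ZMod p) :
    Submodule ℤ V where
  carrier := {x | ∃ a : Fin 3 → ℤ, x = ∑ i, a i • f i ∧ (fun i => (a i : ZMod p)) ⬝ᵥ v = 0}
  zero_mem' := ⟨0, by simp, by simp [dotProduct]⟩
  add_mem' := by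
    rintro _ _ ⟨a, rfl, ha⟩ ⟨b, rfl, hb⟩
    refine ⟨a + b, by simp [add_smul, Finset.sum_add_distrib], ?_⟩
    have : (fun i => ((a + b) i : ZMod p)) = (fun i => (a i : ZMod p)) + fun i => (b i : ZMod p) := by
      ext i; simp
    rw [this, add_dotProduct, ha, hb, add_zero]
  smul_mem' := by
    rintro c _ ⟨a, rfl, ha⟩
    refine ⟨c • a, by simp [Finset.smul_sum, smul_smul], ?_⟩
    have : (fun i => ((c • a) i : ZMod p)) = (c : ZMod p) • fun i => (a i : ZMod p) := by
      ext i; simp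
    rw [this, smul_dotProduct, ha, smul_zero]

lemma mem_congruenceSublattice {p : ℕ} {f : Basis (Fin 3) ℚ V} {v : Fin 3 → ZMod p} {x : V} :
    x ∈ congruenceSublattice f v ↔
      ∃ a : Fin 3 → ℤ, x = ∑ i, a i • f i ∧ (fun i => (a i : ZMod p)) ⬝ᵥ v = 0 := Iff.rfl

lemma sum_zsmul_injective (f : Basis (Fin 3) ℚ V) {a b : Fin 3 → ℤ}
    (h : ∑ i, a i • f i = ∑ i, b i • f i) : a = b := by
  ext i
  have := congrArg (fun x => f.repr x i) h
  simp only [← Int.cast_smul_eq_zsmul ℚ, f.repr_sum_self] at this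
  exact_mod_cast this

lemma sum_mem_congruenceSublattice {p : ℕ} {f : Basis (Fin 3) ℚ V} {v : Fin 3 → ZMod p}
    {a : Fin 3 → ℤ} :
    ∑ i, a i • f i ∈ congruenceSublattice f v ↔ (fun i => (a i : ZMod p)) ⬝ᵥ v = 0 := by
  refine ⟨?_, fun h => ⟨a, rfl, h⟩⟩
  rintro ⟨b, hb, h⟩
  rwa [sum_zsmul_injective f hb]

lemma mem_span_range_basis {f : Basis (Fin 3) ℚ V} {x : V} :
    x ∈ Submodule.span ℤ (Set.range f) ↔ ∃ a : Fin 3 → ℤ, x = ∑ i, a i • f i := by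
  rw [Submodule.mem_span_range_iff_exists_fun]
  exact exists_congr fun _ => eq_comm

lemma apply_sum_zsmul_of_gram_eq_one {B : LinearMap.BilinForm ℚ V} {f : Basis (Fin 3) ℚ V}
    (h : gram B f = 1) (x y : Fin 3 → ℤ) :
    B (∑ i, x i • f i) (∑ i, y i • f i) = ((x ⬝ᵥ y : ℤ) : ℚ) := by
  have := apply_sum_sum_of_gram_eq_one h (fun i => (x i : ℚ)) (fun i => (y i : ℚ))
  simp only [Int.cast_smul_eq_zsmul] at this
  rw [this]
  simp [dotProduct]

lemma intCast_dotProduct {R : Type*} [CommRing R] (x y : Fin 3 → ℤ) :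
    (fun i => (x i : R)) ⬝ᵥ (fun i => (y i : R)) = ((x ⬝ᵥ y : ℤ) : R) := by
  simp [dotProduct]

end

section

variable {V : Type*} [AddCommGroup V] [Module ℚ V]

/-! ### Unimodular overlattices -/

lemma exists_int_sub_eq_pow_mul {p : ℕ} [Fact p.Prime] (n : ℕ) (x : ℤ_[p]) :
    ∃ (a : ℤ) (y : ℤ_[p]), x = a + (p : ℤ_[p]) ^ n * y := by
  obtain ⟨y, hy⟩ := Ideal.mem_span_singleton.1 (PadicInt.appr_spec n x)
  exact ⟨x.appr n, y, by push_cast; linear_combination hy⟩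

/-- The third vector of a local basis of type `⟨1, 1, p²⟩` approximated by a global one: `a` gives its
coordinates and `p² n` its inner products with the basis. -/
lemma exists_int_vector_of_hasGram {p : ℕ} [Fact p.Prime] (B : LinearMap.BilinForm ℚ V)
    (b : Basis (Fin 3) ℚ V) (k : Fin 3 → Fin 3 → ℤ) (hk : ∀ i j, gram B b i j = k i j)
    (hks : ∀ i j, k i j = k j i)
    (hloc : HasGram (B.baseChange ℚ_[p]) (completion p (Submodule.span ℤ (Set.range b)))
      (Matrix.diagonal ![1, 1, (p : ℚ_[p]) ^ 2])) :
    ∃ a n : Fin 3 → ℤ, (∀ j, ∑ i, a i * k i j = (p : ℤ) ^ 2 * n j) ∧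
      ∃ m, ∑ j, a j * n j = 1 + (p : ℤ) * m := by
  obtain ⟨c, hc⟩ := hloc
  have hp0 : (p : ℤ_[p]) ≠ 0 := by exact_mod_cast (Fact.out : p.Prime).ne_zero
  have hbmem : ∀ j, b.baseChange ℚ_[p] j ∈ completion p (Submodule.span ℤ (Set.range b)) := by
    intro j
    rw [completion_span]
    exact Submodule.subset_span (Set.mem_range_self j)
  let β : Fin 3 → completion p (Submodule.span ℤ (Set.range b)) := fun j => ⟨_, hbmem j⟩
  -- `γ` holds the third coordinates of the global basis in the local one, while `α` below expresses
  -- the third local vector in the global basis. Their product is the third coordinate of `c 2`,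
  -- namely 1.
  let γ : Fin 3 → ℤ_[p] := fun j => c.repr (β j) 2
  obtain ⟨α, hα⟩ : ∃ α : Fin 3 → ℤ_[p], ∑ i, α i • β i = c 2 := by
    have h2 : (c 2 : ℚ_[p] ⊗[ℚ] V) ∈ Submodule.span ℤ_[p] (Set.range (b.baseChange ℚ_[p])) := by
      rw [← completion_span]; exact (c 2).2
    obtain ⟨α, hα⟩ := (Submodule.mem_span_range_iff_exists_fun ℤ_[p]).1 h2
    refine ⟨α, Subtype.ext ?_⟩
    rw [← hα]
    simp [β]
  have hαγ : ∑ j, α j * γ j = 1 := by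
    have := congrArg (fun x => c.repr x 2) hα
    simpa [γ] using this
  -- Both sides are the inner product of `c 2` with `b j`: the left one through the global Gram
  -- matrix, the right one through the diagonal local one.
  have hinner : ∀ j, ∑ i, α i * (k i j : ℤ_[p]) = (p : ℤ_[p]) ^ 2 * γ j := by
    intro j
    have h1 : (B.baseChange ℚ_[p]) (c 2) (β j) = ((p : ℤ_[p]) ^ 2 * γ j : ℤ_[p]) := by
      have : (β j : ℚ_[p] ⊗[ℚ] V) = ∑ i, (c.repr (β j) i : ℚ_[p]) • (c i : ℚ_[p] ⊗[ℚ] V) := by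
        conv_lhs => rw [← c.sum_repr (β j)]
        simp only [Submodule.coe_sum, Submodule.coe_smul]
        rfl
      rw [this, Fin.sum_univ_three]
      simp only [map_add, map_smul, hc, smul_eq_mul]
      simp [γ]
      ring
    have h2 : (B.baseChange ℚ_[p]) (c 2) (β j) = (∑ i, α i * (k i j : ℤ_[p]) : ℤ_[p]) := by
      have : (c 2 : ℚ_[p] ⊗[ℚ] V) = ∑ i, (α i : ℚ_[p]) • (β i : ℚ_[p] ⊗[ℚ] V) := by
        rw [← hα]
        simp only [Submodule.coe_sum, Submodule.coe_smul]
        rfl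
      rw [this]
      simp only [map_sum, LinearMap.sum_apply, map_smul, LinearMap.smul_apply]
      rw [PadicInt.coe_sum]
      refine Finset.sum_congr rfl fun i _ => ?_
      have h3 := congrFun (congrFun (gram_baseChange p B b) i) j
      rw [gram_apply, Matrix.map_apply, hk] at h3
      simp only [β, h3]
      simp
    exact PadicInt.ext (h2.symm.trans h1)
  -- Precision `p²` is enough to keep every inner product with the basis divisible by `p²`.
  choose a y hay using fun i => exists_int_sub_eq_pow_mul 2 (α i)
  have hdvd : ∀ j, ∃ n : ℤ, ∑ i, a i * k i j = (p : ℤ) ^ 2 * n := by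
    intro j
    have : ((p : ℤ_[p]) ^ 2) ∣ ((∑ i, a i * k i j : ℤ) : ℤ_[p]) := by
      refine ⟨γ j - ∑ i, y i * k i j, ?_⟩
      rw [mul_sub, ← hinner, Finset.mul_sum, ← Finset.sum_sub_distrib]
      push_cast
      refine Finset.sum_congr rfl fun i _ => ?_
      rw [hay i]; ring
    exact (PadicInt.pow_p_dvd_int_iff 2 _).1 this
  choose n hn using hdvd
  refine ⟨a, n, hn, ?_⟩
  have hnγ : ∀ j, (n j : ℤ_[p]) = γ j - ∑ i, y i * k i j := by
    intro j
    apply mul_left_cancel₀ (pow_ne_zero 2 hp0)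
    have := congrArg (Int.cast : ℤ → ℤ_[p]) (hn j)
    push_cast at this
    rw [← this, mul_sub, ← hinner, Finset.mul_sum, ← Finset.sum_sub_distrib]
    refine Finset.sum_congr rfl fun i _ => ?_
    rw [hay i]; ring
  -- The integers `a`, `n` approximate `α`, `γ`, whose product is 1. By symmetry of the Gram matrix
  -- the error is even a multiple of `p²`.
  have hfin : ((p : ℤ_[p]) ^ 1) ∣ ((∑ j, a j * n j - 1 : ℤ) : ℤ_[p]) := by
    have h1 : ∀ j, (a j : ℤ_[p]) = α j - (p : ℤ_[p]) ^ 2 * y j := fun j => by rw [hay j]; ring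
    have h2 : ∑ j, α j * ∑ i, y i * (k i j : ℤ_[p]) = (p : ℤ_[p]) ^ 2 * ∑ i, y i * γ i := by
      simp only [Finset.mul_sum]
      rw [Finset.sum_comm]
      refine Finset.sum_congr rfl fun i _ => ?_
      rw [mul_left_comm, ← hinner, Finset.mul_sum]
      refine Finset.sum_congr rfl fun j _ => ?_
      rw [hks i j]; ring
    refine ⟨-(p : ℤ_[p]) * (∑ i, y i * γ i + ∑ j, y j * n j), ?_⟩
    push_cast
    have h3 : ∑ j, (a j : ℤ_[p]) * n j = ∑ j, α j * n j - (p : ℤ_[p]) ^ 2 * ∑ j, y j * n j := by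
      rw [Finset.mul_sum, ← Finset.sum_sub_distrib]
      exact Finset.sum_congr rfl fun j _ => by rw [h1 j]; ring
    have h4 : ∑ j, α j * (n j : ℤ_[p]) = 1 - (p : ℤ_[p]) ^ 2 * ∑ i, y i * γ i := by
      rw [← h2, ← hαγ, ← Finset.sum_sub_distrib]
      exact Finset.sum_congr rfl fun j _ => by rw [hnγ j]; ring
    rw [h3, h4]; ring
  obtain ⟨m, hm⟩ := (PadicInt.pow_p_dvd_int_iff 1 _).1 hfin
  exact ⟨m, by linear_combination hm⟩

/-- An integral lattice of discriminant `p²` with a vector as in `exists_int_vector_of_hasGram` is cut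
out of a unimodular lattice by a congruence modulo `p`. -/
lemma exists_eq_congruenceSublattice_of_int_vector {p : ℕ} [Fact p.Prime]
    (B : LinearMap.BilinForm ℚ V) (hsymm : B.IsSymm) (hpos : ∀ x : V, x ≠ 0 → 0 < B x x)
    (b : Basis (Fin 3) ℚ V) (k : Fin 3 → Fin 3 → ℤ) (hk : ∀ i j, gram B b i j = k i j)
    (hdet : (gram B b).det = (p : ℚ) ^ 2) {a n : Fin 3 → ℤ}
    (han : ∀ j, ∑ i, a i * k i j = (p : ℤ) ^ 2 * n j) {m : ℤ}
    (hm : ∑ j, a j * n j = 1 + (p : ℤ) * m) :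
    ∃ f : Basis (Fin 3) ℚ V, gram B f = 1 ∧ ∃ v : Fin 3 → ZMod p, v ⬝ᵥ v = 1 ∧
      Submodule.span ℤ (Set.range b) = congruenceSublattice f v := by
  have hp : p.Prime := Fact.out
  have hp0 : (p : ℚ) ≠ 0 := by exact_mod_cast hp.ne_zero
  obtain ⟨M, hM⟩ : ∃ M, Submodule.span ℤ (Set.range b) = M := ⟨_, rfl⟩
  -- This is the glue vector: `p u ∈ M`, `B(M, u) ⊆ pℤ` and `B(u, u) = 1 + pm`, so adjoining it to
  -- `M` keeps all inner products integral.
  let u : V := (p : ℚ)⁻¹ • ∑ i, a i • b i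
  have hpu : (p : ℤ) • u = ∑ i, a i • b i := by
    rw [← Int.cast_smul_eq_zsmul ℚ, smul_smul]
    push_cast
    rw [mul_inv_cancel₀ hp0, one_smul]
  have hbu : ∀ j, B (b j) u = p * n j := by
    intro j
    have h1 := congrArg (Int.cast : ℤ → ℚ) (han j)
    push_cast at h1
    simp only [u, map_smul, map_sum, ← Int.cast_smul_eq_zsmul ℚ, smul_eq_mul]
    rw [inv_mul_eq_iff_eq_mul₀ hp0, ← mul_assoc, ← sq, ← h1]
    refine Finset.sum_congr rfl fun i _ => ?_
    rw [← hk, gram_apply, hsymm.eq]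
  have hMu : ∀ y ∈ M, ∃ l : ℤ, B y u = p * l := by
    intro y hy
    rw [← hM] at hy
    obtain ⟨l, rfl⟩ := mem_span_range_basis.1 hy
    refine ⟨∑ j, l j * n j, ?_⟩
    simp only [map_sum, LinearMap.sum_apply, ← Int.cast_smul_eq_zsmul ℚ, map_smul,
      LinearMap.smul_apply, hbu, smul_eq_mul]
    push_cast
    rw [Finset.mul_sum]
    exact Finset.sum_congr rfl fun i _ => by ring
  have huu : B u u = 1 + p * m := by
    have h1 := congrArg (Int.cast : ℤ → ℚ) hm
    push_cast at h1
    rw [← h1]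
    conv_lhs => arg 1; rw [show u = (p : ℚ)⁻¹ • ∑ i, a i • b i from rfl]
    simp only [map_smul, LinearMap.smul_apply, map_sum, LinearMap.sum_apply,
      ← Int.cast_smul_eq_zsmul ℚ, hbu, smul_eq_mul, Finset.mul_sum]
    refine Finset.sum_congr rfl fun i _ => ?_
    field_simp
  clear_value u
  have hMM : ∀ x ∈ M, ∀ y ∈ M, ∃ l : ℤ, B x y = l := by
    intro x hx y hy
    rw [← hM] at hx hy
    obtain ⟨r, rfl⟩ := mem_span_range_basis.1 hx
    obtain ⟨s, rfl⟩ := mem_span_range_basis.1 hy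
    refine ⟨∑ i, ∑ j, r i * s j * k i j, ?_⟩
    simp only [map_sum, LinearMap.sum_apply, ← Int.cast_smul_eq_zsmul ℚ, map_smul,
      LinearMap.smul_apply, smul_eq_mul]
    push_cast
    rw [Finset.sum_comm]
    refine Finset.sum_congr rfl fun i _ => ?_
    rw [Finset.mul_sum]
    refine Finset.sum_congr rfl fun j _ => ?_
    rw [← hk, gram_apply]; ring
  -- Otherwise `B(u, u)` would be divisible by `p`.
  have huM : u ∉ M := by
    intro hu
    obtain ⟨l, hl⟩ := hMu u hu
    rw [huu] at hl
    have : (1 : ℤ) = p * (l - m) := by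
      have : (1 : ℚ) = p * (l - m) := by linear_combination hl
      exact_mod_cast this
    have h1 : (p : ℤ) ∣ 1 := ⟨_, this⟩
    exact hp.one_lt.ne' (by exact_mod_cast Int.eq_one_of_dvd_one (by positivity) h1)
  have hMlat : M.IsLattice ℚ := hM ▸ isLattice_span b
  have hKlat : (M ⊔ Submodule.span ℤ {u}).IsLattice ℚ :=
    Submodule.IsLattice.of_le_of_isLattice_of_fg ℚ (M := M) le_sup_left
      (Submodule.FG.sup hMlat.fg (Submodule.fg_span_singleton u))
  have hKmem : ∀ x ∈ M ⊔ Submodule.span ℤ {u}, ∃ y ∈ M, ∃ l : ℤ, x = y + l • u := by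
    intro x hx
    obtain ⟨y, hy, z, hz, rfl⟩ := Submodule.mem_sup.1 hx
    obtain ⟨l, rfl⟩ := Submodule.mem_span_singleton.1 hz
    exact ⟨y, hy, l, rfl⟩
  have huK : u ∈ M ⊔ Submodule.span ℤ {u} :=
    Submodule.mem_sup_right (Submodule.mem_span_singleton_self u)
  obtain ⟨c, hc⟩ := exists_basis_span_eq (Module.finrank_eq_card_basis b) _ hKlat
  have hcmem : ∀ i, c i ∈ M ⊔ Submodule.span ℤ {u} := fun i => by
    rw [← hc]; exact Submodule.subset_span (Set.mem_range_self i)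
  have hcint : ∀ i j, ∃ l : ℤ, gram B c i j = l := by
    intro i j
    obtain ⟨x, hx, r, hxr⟩ := hKmem _ (hcmem i)
    obtain ⟨y, hy, s, hys⟩ := hKmem _ (hcmem j)
    obtain ⟨l₁, h1⟩ := hMM x hx y hy
    obtain ⟨l₂, h2⟩ := hMu x hx
    obtain ⟨l₃, h3⟩ := hMu y hy
    refine ⟨l₁ + s * (p * l₂) + r * (p * l₃) + r * s * (1 + p * m), ?_⟩
    rw [gram_apply, hxr, hys]
    simp only [map_add, LinearMap.add_apply, ← Int.cast_smul_eq_zsmul ℚ, map_smul,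
      LinearMap.smul_apply, smul_eq_mul, h1, h2, huu]
    rw [← hsymm.eq y u]
    simp only [h3]
    push_cast
    ring
  -- The index `T.det` of `M` in the overlattice satisfies `p² = (T.det)² · det`. So it divides `p`,
  -- and it is not a unit because `u ∉ M`; hence it is `±p` and the remaining determinant is 1.
  have hcdet : (gram B c).det = 1 := by
    choose l hl using hcint
    have hG : (Matrix.of l).map (Int.castRingHom ℚ) = gram B c := by
      ext i j; simp [hl]
    have hbK : ∀ j, ∃ t : Fin 3 → ℤ, b j = ∑ i, t i • c i := by
      intro j
      apply mem_span_range_basis.1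
      rw [hc]
      exact Submodule.mem_sup_left (hM ▸ Submodule.subset_span (Set.mem_range_self j))
    choose t ht using hbK
    let T : Matrix (Fin 3) (Fin 3) ℤ := Matrix.of fun i j => t j i
    have h1 := gram_of_eq_sum B (b := b) (c := c) (T := T.map (Int.castRingHom ℚ)) fun j => by
      rw [ht j]
      simp [T, Int.cast_smul_eq_zsmul]
    have h2 : (p : ℤ) ^ 2 = T.det ^ 2 * (Matrix.of l).det := by
      have := congrArg Matrix.det h1
      rw [hdet, ← hG, ← Matrix.transpose_map, ← Matrix.map_mul, ← Matrix.map_mul,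
        ← RingHom.mapMatrix_apply, ← RingHom.map_det, det_mul, det_mul, det_transpose] at this
      have h3 : (p : ℤ) ^ 2 = T.det * (Matrix.of l).det * T.det := by
        simp only [eq_intCast] at this
        exact_mod_cast this
      rw [h3]; ring
    have h3 : T.det ∣ p := by
      rw [← Int.pow_dvd_pow_iff two_ne_zero]
      exact ⟨_, h2⟩
    have h4 : ¬ IsUnit T.det := by
      intro hT
      apply huM
      rw [← hc] at huK
      have hcb : Submodule.span ℤ (Set.range c) ≤ M := by
        rw [Submodule.span_le]
        rintro _ ⟨j, rfl⟩
        have hTT := Matrix.mul_nonsing_inv T hT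
        have : c j = ∑ i, (T⁻¹) i j • b i := by
          simp only [ht, Finset.smul_sum, smul_smul]
          rw [Finset.sum_comm]
          have h5 : ∀ i, ∑ x, (T⁻¹ x j * t x i) • c i = ((T * T⁻¹) i j) • c i := by
            intro i
            rw [Matrix.mul_apply, Finset.sum_smul]
            exact Finset.sum_congr rfl fun x _ => by rw [mul_comm]; rfl
          simp only [h5, hTT, Matrix.one_apply, ite_smul,
            one_smul, zero_smul, Finset.sum_ite_eq', Finset.mem_univ, if_true]
        rw [SetLike.mem_coe, this, ← hM]
        exact Submodule.sum_mem _ fun i _ =>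
          Submodule.smul_mem _ _ (Submodule.subset_span (Set.mem_range_self i))
      exact hcb huK
    have h5 : T.det.natAbs = p := by
      have : T.det.natAbs ∣ p := by
        rw [← Int.natAbs_natCast p]; exact Int.natAbs_dvd_natAbs.2 h3
      exact ((Nat.dvd_prime hp).1 this).resolve_left fun h => h4 (Int.isUnit_iff_natAbs_eq.2 h)
    have h6 : T.det ^ 2 = (p : ℤ) ^ 2 := by rw [← Int.natAbs_sq, h5]
    rw [h6] at h2
    have h7 : (Matrix.of l).det = 1 := by
      have hp2 : (p : ℤ) ^ 2 ≠ 0 := pow_ne_zero 2 (by exact_mod_cast hp.ne_zero)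
      exact mul_left_cancel₀ hp2 (by rw [← h2, mul_one])
    rw [← hG, ← RingHom.mapMatrix_apply, ← RingHom.map_det, h7, map_one]
  obtain ⟨f, hf, hfc⟩ := exists_orthonormal_basis B hsymm hpos c hcint hcdet
  rw [hc] at hfc
  -- The vector `v` is the reduction of the coordinates `w` of `u`: pairing with `u` modulo `p` is
  -- then `· ⬝ᵥ v`.
  obtain ⟨w, hw⟩ := mem_span_range_basis.1 (hfc ▸ huK)
  have hyu : ∀ e : Fin 3 → ℤ, B (∑ i, e i • f i) u = ((e ⬝ᵥ w : ℤ) : ℚ) := fun e => by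
    rw [hw, apply_sum_zsmul_of_gram_eq_one hf]
  refine ⟨f, hf, fun i => w i, ?_, ?_⟩
  · have h1 := hyu w
    rw [← hw, huu] at h1
    have h2 : w ⬝ᵥ w = 1 + p * m := by exact_mod_cast h1.symm
    rw [intCast_dotProduct, h2]
    simp
  · rw [hM]
    ext y
    rw [mem_congruenceSublattice]
    constructor
    · intro hy
      obtain ⟨e, rfl⟩ := mem_span_range_basis.1
        (hfc ▸ (Submodule.mem_sup_left hy : y ∈ M ⊔ Submodule.span ℤ {u}))
      refine ⟨e, rfl, ?_⟩
      obtain ⟨l, hl⟩ := hMu _ hy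
      rw [hyu] at hl
      have h2 : e ⬝ᵥ w = p * l := by exact_mod_cast hl
      rw [intCast_dotProduct, h2]
      simp
    · rintro ⟨e, rfl, he⟩
      have hmem : ∑ i, e i • f i ∈ M ⊔ Submodule.span ℤ {u} := by
        rw [← hfc]; exact mem_span_range_basis.2 ⟨e, rfl⟩
      obtain ⟨y, hy, l, hyl⟩ := hKmem _ hmem
      rw [intCast_dotProduct, ZMod.intCast_zmod_eq_zero_iff_dvd] at he
      obtain ⟨r, hr⟩ := he
      obtain ⟨s, hs⟩ := hMu y hy
      have h1 := hyu e
      rw [hyl, map_add, LinearMap.add_apply, ← Int.cast_smul_eq_zsmul ℚ, map_smul,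
        LinearMap.smul_apply, hs, huu, hr, smul_eq_mul] at h1
      -- For `y + l u` with `y ∈ M`, the congruence says `p ∣ l (1 + pm)`, so `p ∣ l`, and `p u ∈ M`
      -- puts the vector in `M`.
      have h2 : l = p * (r - s - l * m) := by
        have : (l : ℚ) = p * (r - s - l * m) := by push_cast at h1; linear_combination h1
        exact_mod_cast this
      rw [hyl, h2, mul_comm, mul_smul, hpu]
      refine M.add_mem hy (M.smul_mem _ ?_)
      rw [← hM]
      exact mem_span_range_basis.2 ⟨a, rfl⟩

end

section

/-! ### Isometries between orthonormal bases -/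

section Isometry

variable {K W : Type*} [Field K] [AddCommGroup W] [Module K W] {B : LinearMap.BilinForm K W}

/-- The isometry taking one orthonormal basis to another. -/
noncomputable def isometryOfBases (f g : Basis (Fin 3) K W) (hf : gram B f = 1)
    (hg : gram B g = 1) : B.IsometryEquiv B where
  toLinearEquiv := f.equiv g (Equiv.refl _)
  map_app' x y := by
    have h : ∀ z, f.equiv g (Equiv.refl _) z = ∑ i, f.repr z i • g i := by
      intro z
      conv_lhs => rw [← f.sum_repr z]
      simp only [map_sum, map_smul, Basis.equiv_apply, Equiv.refl_apply]
    have hB : B x y = (fun i => f.repr x i) ⬝ᵥ (fun i => f.repr y i) := by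
      conv_lhs => rw [← f.sum_repr x, ← f.sum_repr y]
      exact apply_sum_sum_of_gram_eq_one hf _ _
    rw [hB, ← apply_sum_sum_of_gram_eq_one hg, ← h, ← h]
    rfl

lemma isometryOfBases_apply (f g : Basis (Fin 3) K W) (hf : gram B f = 1) (hg : gram B g = 1)
    (i : Fin 3) : isometryOfBases f g hf hg (f i) = g i := by
  change f.equiv g (Equiv.refl _) (f i) = _
  simp

lemma isometry_sum (σ : B.IsometryEquiv B) (x : Fin 3 → K) (f : Fin 3 → W) :
    σ (∑ i, x i • f i) = ∑ i, x i • σ (f i) := by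
  simp only [map_sum, map_smul]

lemma isometry_zsum (σ : B.IsometryEquiv B) (x : Fin 3 → ℤ) (f : Fin 3 → W) :
    σ (∑ i, x i • f i) = ∑ i, x i • σ (f i) := by
  simp only [map_sum, map_zsmul]

/-- The image of an orthonormal basis under an orthogonal matrix. -/
noncomputable def orthogonalBasis (e : Basis (Fin 3) K W) (he : gram B e = 1)
    (A : Matrix (Fin 3) (Fin 3) K) (hA : Aᵀ * A = 1) : Basis (Fin 3) K W :=
  basisOfLinearIndependentOfCardEqFinrank (b := fun j => ∑ i, A i j • e i)
    (linearIndependent_of_gram_eq_one (B := B) (by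
      rw [gram_of_eq_sum B (c := e) (T := A) fun _ => rfl, he, Matrix.mul_one, hA]))
    (Module.finrank_eq_card_basis e).symm

lemma orthogonalBasis_apply (e : Basis (Fin 3) K W) (he : gram B e = 1)
    (A : Matrix (Fin 3) (Fin 3) K) (hA : Aᵀ * A = 1) (j : Fin 3) :
    orthogonalBasis e he A hA j = ∑ i, A i j • e i :=
  congrFun (coe_basisOfLinearIndependentOfCardEqFinrank _ _) j

lemma gram_orthogonalBasis (e : Basis (Fin 3) K W) (he : gram B e = 1)
    (A : Matrix (Fin 3) (Fin 3) K) (hA : Aᵀ * A = 1) : gram B (orthogonalBasis e he A hA) = 1 := by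
  rw [gram_of_eq_sum B (orthogonalBasis_apply e he A hA), he, Matrix.mul_one, hA]

/-- The isometry with orthogonal matrix `A` in an orthonormal basis. -/
noncomputable def orthogonalIsometry (e : Basis (Fin 3) K W) (he : gram B e = 1)
    (A : Matrix (Fin 3) (Fin 3) K) (hA : Aᵀ * A = 1) : B.IsometryEquiv B :=
  isometryOfBases e (orthogonalBasis e he A hA) he (gram_orthogonalBasis e he A hA)

lemma orthogonalIsometry_apply (e : Basis (Fin 3) K W) (he : gram B e = 1)
    (A : Matrix (Fin 3) (Fin 3) K) (hA : Aᵀ * A = 1) (j : Fin 3) :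
    orthogonalIsometry e he A hA (e j) = ∑ i, A i j • e i := by
  rw [orthogonalIsometry, isometryOfBases_apply, orthogonalBasis_apply]

end Isometry

variable {V : Type*} [AddCommGroup V] [Module ℚ V]

/-! ### Classes and genera -/

lemma latticeClass_eq_of_image_eq {B : LinearMap.BilinForm ℚ V} (σ : B.IsometryEquiv B)
    {M M' : Submodule ℤ V} (h : σ '' (M : Set V) = M') :
    latticeClass B M = latticeClass B M' := by
  ext X
  constructor
  · rintro ⟨τ, hτ⟩
    refine ⟨σ.symm.trans τ, ?_⟩
    rw [← hτ, ← image_symm_eq σ h, Set.image_image]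
    rfl
  · rintro ⟨τ, hτ⟩
    refine ⟨σ.trans τ, ?_⟩
    rw [← hτ, ← h, Set.image_image]
    rfl

lemma latticeClass_eq_iff {B : LinearMap.BilinForm ℚ V} {M M' : Submodule ℤ V} :
    latticeClass B M = latticeClass B M' ↔ ∃ σ : B.IsometryEquiv B, σ '' (M : Set V) = M' := by
  refine ⟨fun h => ?_, fun ⟨σ, hσ⟩ => latticeClass_eq_of_image_eq σ hσ⟩
  have : M' ∈ latticeClass B M' := ⟨LinearMap.BilinForm.IsometryEquiv.refl B, Set.image_id _⟩
  rw [← h] at this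
  exact this

lemma self_mem_genus (B : LinearMap.BilinForm ℚ V) (L : Submodule ℤ V) (hL : L.IsLattice ℚ) :
    L ∈ genus B L :=
  ⟨hL, fun _ _ => ⟨LinearMap.BilinForm.IsometryEquiv.refl _, Set.image_id _⟩⟩

lemma exists_basis_of_hasDiscriminant (hV : finrank ℚ V = 3) {B : LinearMap.BilinForm ℚ V}
    {L : Submodule ℤ V} (hL : L.IsLattice ℚ) {d : ℚ} (hd : HasDiscriminant B L d) :
    ∃ b : Basis (Fin 3) ℚ V, Submodule.span ℤ (Set.range b) = L ∧ (gram B b).det = d := by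
  obtain ⟨n, A, ⟨c, hc⟩, rfl⟩ := hd
  have hn : n = 3 := by
    have := Module.finrank_eq_card_basis (c.extendOfIsLattice ℚ)
    rw [hV, Fintype.card_fin] at this
    exact this.symm
  subst hn
  refine ⟨c.extendOfIsLattice ℚ, ?_, ?_⟩
  · have : (c.extendOfIsLattice ℚ : _ → V) = L.subtype ∘ c := by
      ext k; simp
    rw [this, Set.range_comp, ← Submodule.map_span, c.span_eq, Submodule.map_top,
      Submodule.range_subtype]
  · congr 1
    ext i j
    rw [gram_apply, Basis.extendOfIsLattice_apply, Basis.extendOfIsLattice_apply]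
    exact hc i j

lemma hasGram_span (B : LinearMap.BilinForm ℚ V) (b : Basis (Fin 3) ℚ V) :
    HasGram B (Submodule.span ℤ (Set.range b)) (gram B b) :=
  ⟨b.restrictScalars ℤ, fun i j => by
    rw [Basis.restrictScalars_apply, Basis.restrictScalars_apply, gram_apply]⟩

lemma HasGram.of_image_eq {q : ℕ} [Fact q.Prime] {B : LinearMap.BilinForm ℚ V}
    {N N' : Submodule ℤ_[q] (ℚ_[q] ⊗[ℚ] V)} {n : ℕ} {A : Matrix (Fin n) (Fin n) ℚ_[q]}
    (h : HasGram (B.baseChange ℚ_[q]) N A)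
    (σ : (B.baseChange ℚ_[q]).IsometryEquiv (B.baseChange ℚ_[q]))
    (hσ : σ '' (N : Set (ℚ_[q] ⊗[ℚ] V)) = N') : HasGram (B.baseChange ℚ_[q]) N' A := by
  obtain ⟨c, hc⟩ := h
  let e : (ℚ_[q] ⊗[ℚ] V) ≃ₗ[ℤ_[q]] (ℚ_[q] ⊗[ℚ] V) := σ.toLinearEquiv.restrictScalars ℤ_[q]
  have hN : N.map (e : (ℚ_[q] ⊗[ℚ] V) →ₗ[ℤ_[q]] (ℚ_[q] ⊗[ℚ] V)) = N' := SetLike.coe_injective hσ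
  subst hN
  refine ⟨c.map (e.submoduleMap N), fun i j => ?_⟩
  rw [Basis.map_apply, Basis.map_apply, ← hc i j, LinearEquiv.submoduleMap_apply,
    LinearEquiv.submoduleMap_apply]
  exact σ.map_app _ _

lemma exists_int_eq_of_isPrimitive {B : LinearMap.BilinForm ℚ V} {L : Submodule ℤ V}
    (h : IsPrimitive B L) {x y : V} (hx : x ∈ L) (hy : y ∈ L) : ∃ k : ℤ, B x y = k := by
  have : B x y ∈ scale B L := Submodule.subset_span ⟨x, hx, y, hy, rfl⟩
  rw [h, Submodule.mem_one] at this
  obtain ⟨k, hk⟩ := this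
  exact ⟨k, by rw [← hk]; simp⟩

/-- Integrality, determinant and the local shape at `p` pass from `L` to all of its genus, and the
unimodular overlattice needs nothing else. -/
theorem exists_eq_congruenceSublattice_of_mem_genus {p : ℕ} [Fact p.Prime]
    (hV : finrank ℚ V = 3) {B : LinearMap.BilinForm ℚ V} (hsymm : B.IsSymm)
    (hpos : ∀ x : V, x ≠ 0 → 0 < B x x) {L : Submodule ℤ V} (hL : L.IsLattice ℚ)
    (hprim : IsPrimitive B L) (hdisc : HasDiscriminant B L ((p : ℚ) ^ 2))
    (hloc : HasGram (B.baseChange ℚ_[p]) (completion p L)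
      (Matrix.diagonal ![1, 1, (p : ℚ_[p]) ^ 2])) {M : Submodule ℤ V} (hM : M ∈ genus B L) :
    ∃ f : Basis (Fin 3) ℚ V, gram B f = 1 ∧ ∃ v : Fin 3 → ZMod p, v ⬝ᵥ v = 1 ∧
      M = congruenceSublattice f v := by
  have hp0 : (0 : ℚ) < (p : ℚ) ^ 2 := by
    have := (Fact.out : p.Prime).pos
    positivity
  obtain ⟨b, rfl, hb⟩ := exists_basis_of_hasDiscriminant hV hL hdisc
  obtain ⟨c, rfl⟩ := exists_basis_span_eq hV M hM.1
  have hbpos : 0 < (gram B b).det := hb ▸ hp0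
  have hc := det_gram_eq_of_mem_genus B b c hbpos (det_gram_pos B b c hbpos) hM
  rw [hb] at hc
  have hbint : ∀ i j, ∃ k : ℤ, gram B b i j = 1 * k := fun i j => by
    simpa [gram_apply] using exists_int_eq_of_isPrimitive hprim (Submodule.subset_span (Set.mem_range_self i))
      (Submodule.subset_span (Set.mem_range_self j))
  choose k hk using gram_mem_of_mem_genus B b c 1 one_ne_zero hbint hM
  simp only [one_mul] at hk
  have hks : ∀ i j, k i j = k j i := by
    intro i j
    have : (k i j : ℚ) = k j i := by rw [← hk, ← hk, gram_apply, gram_apply, hsymm.eq]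
    exact_mod_cast this
  obtain ⟨σ, hσ⟩ := hM.2 p
  obtain ⟨a, n, han, m, hm⟩ := exists_int_vector_of_hasGram B c k hk hks (hloc.of_image_eq σ hσ)
  exact exists_eq_congruenceSublattice_of_int_vector B hsymm hpos c k hk hc han hm

/-! ### The Watson transform of a congruence sublattice -/

/-- The basis `s f₀, s f₁, s f₂`. -/
noncomputable def scaledBasis (s : ℚˣ) (f : Basis (Fin 3) ℚ V) : Basis (Fin 3) ℚ V :=
  f.unitsSMul fun _ => s

lemma scaledBasis_apply (s : ℚˣ) (f : Basis (Fin 3) ℚ V) (i : Fin 3) :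
    scaledBasis s f i = (s : ℚ) • f i := Basis.unitsSMul_apply i

lemma gram_scaledBasis (B : LinearMap.BilinForm ℚ V) (s : ℚˣ) (f : Basis (Fin 3) ℚ V) :
    gram B (scaledBasis s f) = (s : ℚ) ^ 2 • gram B f := by
  ext i j
  simp only [gram_apply, scaledBasis_apply, map_smul, LinearMap.smul_apply, Matrix.smul_apply,
    smul_eq_mul]
  ring

/-- A prime number as a unit of `ℚ`. -/
def primeUnit (p : ℕ) [Fact p.Prime] : ℚˣ :=
  Units.mk0 p (by exact_mod_cast (Fact.out : p.Prime).ne_zero)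

lemma two_ne_zero_zmod {p : ℕ} [Fact p.Prime] (hp : p ≠ 2) : (2 : ZMod p) ≠ 0 := by
  intro h
  have h3 : ((2 : ℕ) : ZMod p) = 0 := by exact_mod_cast h
  rw [ZMod.natCast_eq_zero_iff] at h3
  exact hp ((Nat.prime_dvd_prime_iff_eq Fact.out Nat.prime_two).1 h3)

/-- As `p` is odd, the Watson condition on a vector with coordinates `a` says that `p ∣ Q` and that
`a` is orthogonal modulo `p` to the hyperplane `v^⊥`. Since also `a ⬝ᵥ v = 0` and `v` is
anisotropic, `a` vanishes modulo `p`. -/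
lemma watson_congruenceSublattice {p : ℕ} [Fact p.Prime] (hp : p ≠ 2)
    {B : LinearMap.BilinForm ℚ V} {f : Basis (Fin 3) ℚ V} (hf : gram B f = 1)
    {v : Fin 3 → ZMod p} (hv : v ⬝ᵥ v = 1) :
    watson B p (congruenceSublattice f v) =
      Submodule.span ℤ (Set.range (scaledBasis (primeUnit p) f)) := by
  have h2 := two_ne_zero_zmod hp
  have hscaled : ∀ a : Fin 3 → ℤ, ∑ i, a i • scaledBasis (primeUnit p) f i =
      ∑ i, (p * a i) • f i := by
    intro a
    refine Finset.sum_congr rfl fun i _ => ?_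
    rw [scaledBasis_apply, mul_comm, mul_smul, ← Int.cast_smul_eq_zsmul ℚ (p : ℤ) (f i)]
    rfl
  have hB : ∀ a b : Fin 3 → ℤ, B (∑ i, a i • f i + ∑ i, b i • f i)
      (∑ i, a i • f i + ∑ i, b i • f i) - B (∑ i, b i • f i) (∑ i, b i • f i) =
      ((a ⬝ᵥ a + 2 * (a ⬝ᵥ b) : ℤ) : ℚ) := by
    intro a b
    simp only [map_add, LinearMap.add_apply, apply_sum_zsmul_of_gram_eq_one hf]
    rw [dotProduct_comm b a]
    push_cast; ring
  have hmem : ∀ x, x ∈ watson B p (congruenceSublattice f v) ↔ x ∈ congruenceSublattice f v ∧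
      ∀ y ∈ congruenceSublattice f v, ∃ k : ℤ, B (x + y) (x + y) - B y y = p * k := fun _ => Iff.rfl
  ext x
  rw [hmem, mem_span_range_basis]
  constructor
  · rintro ⟨⟨a, rfl, ha⟩, h⟩
    have h1 : ∀ b : Fin 3 → ℤ, (fun i => (b i : ZMod p)) ⬝ᵥ v = 0 →
        ((a ⬝ᵥ a + 2 * (a ⬝ᵥ b) : ℤ) : ZMod p) = 0 := by
      intro b hb
      obtain ⟨k, hk⟩ := h _ ⟨b, rfl, hb⟩
      rw [hB] at hk
      have : a ⬝ᵥ a + 2 * (a ⬝ᵥ b) = p * k := by exact_mod_cast hk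
      rw [this]; simp
    have h0 : ((a ⬝ᵥ a : ℤ) : ZMod p) = 0 := by
      simpa using h1 0 (by simp [dotProduct])
    have h3 : ∀ β : Fin 3 → ZMod p, β ⬝ᵥ v = 0 → (fun i => (a i : ZMod p)) ⬝ᵥ β = 0 := by
      intro β hβ
      choose b hb using fun i => ZMod.intCast_surjective (β i)
      obtain rfl : (fun i => (b i : ZMod p)) = β := funext hb
      have := h1 b hβ
      push_cast at this
      rw [h0, zero_add] at this
      rw [intCast_dotProduct]
      exact (mul_eq_zero.1 this).resolve_left h2
    have h4 : ∀ i, (a i : ZMod p) = 0 := by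
      intro i
      -- This is the projection of the `i`-th unit vector to `v^⊥`; pairing it with `a` gives the
      -- `i`-th coordinate because `a ⬝ᵥ v = 0`.
      have := h3 (Pi.single i 1 - v i • v) (by
        rw [sub_dotProduct, smul_dotProduct, hv]; simp)
      rw [dotProduct_sub, dotProduct_smul, ha] at this
      simpa using this
    choose c hc using fun i => (ZMod.intCast_zmod_eq_zero_iff_dvd _ _).1 (h4 i)
    exact ⟨c, by rw [hscaled]; exact Finset.sum_congr rfl fun i _ => by rw [hc i]⟩
  · rintro ⟨c, rfl⟩
    rw [hscaled]
    refine ⟨⟨fun i => p * c i, rfl, by simp [dotProduct]⟩, ?_⟩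
    rintro _ ⟨b, rfl, hb⟩
    rw [hB]
    refine ⟨p * (c ⬝ᵥ c) + 2 * (c ⬝ᵥ b), ?_⟩
    have : (fun i => (p : ℤ) * c i) = (p : ℤ) • c := rfl
    rw [this]
    simp only [smul_dotProduct, dotProduct_smul, smul_eq_mul]
    push_cast; ring

/-! ### The class number of a scaled unimodular lattice -/

lemma scaledBasis_inv (s : ℚˣ) (f : Basis (Fin 3) ℚ V) : scaledBasis s (scaledBasis s⁻¹ f) = f := by
  apply Basis.eq_of_apply_eq
  intro i
  rw [scaledBasis_apply, scaledBasis_apply, smul_smul, Units.mul_inv, one_smul]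

lemma span_scaledBasis_congr (s : ℚˣ) {f g : Basis (Fin 3) ℚ V}
    (h : Submodule.span ℤ (Set.range f) ≤ Submodule.span ℤ (Set.range g)) :
    Submodule.span ℤ (Set.range (scaledBasis s f)) ≤
      Submodule.span ℤ (Set.range (scaledBasis s g)) := by
  rw [Submodule.span_le]
  rintro _ ⟨i, rfl⟩
  obtain ⟨a, ha⟩ := mem_span_range_basis.1 (h (Submodule.subset_span (Set.mem_range_self i)))
  refine mem_span_range_basis.2 ⟨a, ?_⟩
  rw [scaledBasis_apply, ha, Finset.smul_sum]
  refine Finset.sum_congr rfl fun j _ => ?_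
  rw [scaledBasis_apply, smul_comm]

lemma span_scaledBasis_eq_iff (s : ℚˣ) {f g : Basis (Fin 3) ℚ V} :
    Submodule.span ℤ (Set.range (scaledBasis s f)) =
      Submodule.span ℤ (Set.range (scaledBasis s g)) ↔
    Submodule.span ℤ (Set.range f) = Submodule.span ℤ (Set.range g) := by
  have key : ∀ (s : ℚˣ) (f g : Basis (Fin 3) ℚ V),
      Submodule.span ℤ (Set.range f) = Submodule.span ℤ (Set.range g) →
      Submodule.span ℤ (Set.range (scaledBasis s f)) =
      Submodule.span ℤ (Set.range (scaledBasis s g)) := fun s f g h =>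
    le_antisymm (span_scaledBasis_congr s h.le) (span_scaledBasis_congr s h.ge)
  refine ⟨fun h => ?_, key s f g⟩
  have := key s⁻¹ _ _ h
  have hi : ∀ f : Basis (Fin 3) ℚ V, scaledBasis s⁻¹ (scaledBasis s f) = f := fun f => by
    simpa using scaledBasis_inv s⁻¹ f
  rwa [hi, hi] at this

lemma image_span_of_apply_eq {B : LinearMap.BilinForm ℚ V} (σ : B.IsometryEquiv B)
    {f g : Basis (Fin 3) ℚ V} (h : ∀ i, σ (f i) = g i) :
    σ '' (Submodule.span ℤ (Set.range f) : Set V) = Submodule.span ℤ (Set.range g) := by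
  ext x
  simp only [Set.mem_image, SetLike.mem_coe, mem_span_range_basis]
  constructor
  · rintro ⟨_, ⟨a, rfl⟩, rfl⟩
    exact ⟨a, by simp only [isometry_zsum, h]⟩
  · rintro ⟨a, rfl⟩
    exact ⟨_, ⟨a, rfl⟩, by simp only [isometry_zsum, h]⟩

/-- Any lattice in the genus has Gram matrix divisible by `s²` and determinant `s⁶`, so scaling it
by `s⁻¹` gives a unimodular lattice, which has an orthonormal basis. -/
theorem classNumber_span_scaledBasis {B : LinearMap.BilinForm ℚ V} (hsymm : B.IsSymm)
    (hpos : ∀ x : V, x ≠ 0 → 0 < B x x) (s : ℚˣ) {f : Basis (Fin 3) ℚ V} (hf : gram B f = 1) :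
    classNumber B (Submodule.span ℤ (Set.range (scaledBasis s f))) = 1 := by
  have hs : (s : ℚ) ^ 2 ≠ 0 := pow_ne_zero 2 s.ne_zero
  have hdet : (gram B (scaledBasis s f)).det = ((s : ℚ) ^ 2) ^ 3 := by
    rw [gram_scaledBasis, hf, det_smul, det_one, Fintype.card_fin, mul_one]
  have hdpos : 0 < (gram B (scaledBasis s f)).det := by
    rw [hdet]; positivity
  rw [classNumber, numClasses, Set.ncard_eq_one]
  refine ⟨latticeClass B (Submodule.span ℤ (Set.range (scaledBasis s f))), ?_⟩
  refine Set.eq_singleton_iff_nonempty_unique_mem.2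
    ⟨⟨_, _, self_mem_genus B _ (isLattice_span _), rfl⟩, ?_⟩
  rintro _ ⟨M, hM, rfl⟩
  obtain ⟨c, rfl⟩ := exists_basis_span_eq (Module.finrank_eq_card_basis f) M hM.1
  have hc := det_gram_eq_of_mem_genus B _ c hdpos (det_gram_pos B _ c hdpos) hM
  have hint : ∀ i j, ∃ k : ℤ, gram B (scaledBasis s f) i j = (s : ℚ) ^ 2 * k := fun i j => by
    rw [gram_scaledBasis, hf]
    refine ⟨(1 : Matrix (Fin 3) (Fin 3) ℤ) i j, ?_⟩
    by_cases h : i = j <;> simp [Matrix.one_apply, h]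
  have hcint := gram_mem_of_mem_genus B _ c _ hs hint hM
  have hgr : gram B (scaledBasis s⁻¹ c) = ((s : ℚ) ^ 2)⁻¹ • gram B c := by
    rw [gram_scaledBasis]; simp
  obtain ⟨g, hg, hgc⟩ := exists_orthonormal_basis B hsymm hpos (scaledBasis s⁻¹ c) (by
      intro i j
      obtain ⟨k, hk⟩ := hcint i j
      refine ⟨k, ?_⟩
      rw [hgr, Matrix.smul_apply, hk, smul_eq_mul, inv_mul_cancel_left₀ hs]) (by
      rw [hgr, det_smul, hc, hdet, Fintype.card_fin, inv_pow, inv_mul_cancel₀ (pow_ne_zero 3 hs)])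
  have h1 := (span_scaledBasis_eq_iff s).2 hgc
  rw [scaledBasis_inv] at h1
  rw [← h1]
  refine (latticeClass_eq_of_image_eq (isometryOfBases f g hf hg)
    (image_span_of_apply_eq _ fun i => ?_)).symm
  rw [scaledBasis_apply, scaledBasis_apply, map_smul, isometryOfBases_apply]

end

/-! ### Elementary properties of congruence sublattices. -/

section

variable {V : Type*} [AddCommGroup V] [Module ℚ V]

lemma transpose_mulVec_dotProduct_mulVec {R : Type*} [CommRing R] {A : Matrix (Fin 3) (Fin 3) R}
    (hA : Aᵀ * A = 1) (x y : Fin 3 → R) : (A *ᵥ x) ⬝ᵥ (A *ᵥ y) = x ⬝ᵥ y := by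
  rw [dotProduct_mulVec, ← mulVec_transpose, mulVec_mulVec, hA, one_mulVec]

lemma congruenceSublattice_neg {p : ℕ} (e : Basis (Fin 3) ℚ V) (v : Fin 3 → ZMod p) :
    congruenceSublattice e (-v) = congruenceSublattice e v := by
  ext x
  simp only [mem_congruenceSublattice, dotProduct_neg, neg_eq_zero]

lemma congruenceSublattice_le_span {p : ℕ} (e : Basis (Fin 3) ℚ V) (v : Fin 3 → ZMod p) :
    congruenceSublattice e v ≤ Submodule.span ℤ (Set.range e) := by
  rintro _ ⟨a, rfl, -⟩
  exact mem_span_range_basis.2 ⟨a, rfl⟩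

lemma smul_mem_congruenceSublattice {p : ℕ} (e : Basis (Fin 3) ℚ V) (v : Fin 3 → ZMod p) {x : V}
    (hx : x ∈ Submodule.span ℤ (Set.range e)) : (p : ℤ) • x ∈ congruenceSublattice e v := by
  obtain ⟨a, rfl⟩ := mem_span_range_basis.1 hx
  refine ⟨fun i => p * a i, ?_, by simp [dotProduct]⟩
  simp only [Finset.smul_sum, smul_smul]

lemma isLattice_congruenceSublattice {p : ℕ} [Fact p.Prime] (e : Basis (Fin 3) ℚ V)
    (v : Fin 3 → ZMod p) : (congruenceSublattice e v).IsLattice ℚ := by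
  have h1 := isLattice_span (scaledBasis (primeUnit p) e)
  refine Submodule.IsLattice.of_le_of_isLattice_of_fg ℚ
    (M := Submodule.span ℤ (Set.range (scaledBasis (primeUnit p) e))) ?_ ?_
  · rw [Submodule.span_le]
    rintro _ ⟨i, rfl⟩
    have := smul_mem_congruenceSublattice e v (Submodule.subset_span (Set.mem_range_self i))
    rw [← Int.cast_smul_eq_zsmul ℚ] at this
    simpa [scaledBasis_apply, primeUnit] using this
  · have : IsNoetherian ℤ (Submodule.span ℤ (Set.range e)) :=
      isNoetherian_of_fg_of_noetherian _ (isLattice_span e).fg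
    exact isNoetherian_submodule.1 this _ (congruenceSublattice_le_span e v)

/-! ### Completions of congruence sublattices -/

lemma completion_mono {q : ℕ} [Fact q.Prime] {M N : Submodule ℤ V} (h : M ≤ N) :
    completion q M ≤ completion q N :=
  Submodule.span_mono (Set.image_mono h)

/-- The sublattice contains `p` times the full lattice, and `p` is a unit in `ℤ_q`. -/
lemma completion_congruenceSublattice_of_ne {p q : ℕ} [Fact p.Prime] [Fact q.Prime] (hpq : q ≠ p)
    (e : Basis (Fin 3) ℚ V) (v : Fin 3 → ZMod p) :
    completion q (congruenceSublattice e v) = completion q (Submodule.span ℤ (Set.range e)) := by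
  refine le_antisymm (completion_mono (congruenceSublattice_le_span e v)) (Submodule.span_le.2 ?_)
  rintro _ ⟨x, hx, rfl⟩
  have hu : IsUnit (p : ℤ_[q]) := by
    rw [PadicInt.isUnit_iff]
    refine le_antisymm (PadicInt.norm_le_one _) (not_lt.1 fun h => ?_)
    have := (PadicInt.norm_int_lt_one_iff_dvd (p := q) (p : ℤ)).1 (by exact_mod_cast h)
    exact hpq ((Nat.prime_dvd_prime_iff_eq Fact.out Fact.out).1 (by exact_mod_cast this))
  obtain ⟨t, ht⟩ := hu.exists_left_inv
  have h1 : (1 : ℚ_[q]) ⊗ₜ[ℚ] ((p : ℤ) • x) ∈ completion q (congruenceSublattice e v) :=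
    Submodule.subset_span ⟨_, smul_mem_congruenceSublattice e v hx, rfl⟩
  have h2 := Submodule.smul_mem _ t h1
  have h3 : t • ((1 : ℚ_[q]) ⊗ₜ[ℚ] ((p : ℤ) • x)) = (1 : ℚ_[q]) ⊗ₜ[ℚ] x := by
    rw [TensorProduct.tmul_smul, ← Int.cast_smul_eq_zsmul ℤ_[q], smul_smul, Int.cast_natCast, ht,
      one_smul]
  rwa [h3] at h2

/-- Completing keeps the same congruence: `p`-adic coordinates differ from integers by multiples of
`p`, and the sublattice contains `p` times the full lattice. -/
lemma mem_completion_congruenceSublattice {p : ℕ} [Fact p.Prime] (e : Basis (Fin 3) ℚ V)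
    (v : Fin 3 → ZMod p) (y : ℚ_[p] ⊗[ℚ] V) :
    y ∈ completion p (congruenceSublattice e v) ↔ ∃ α : Fin 3 → ℤ_[p],
      y = ∑ i, α i • e.baseChange ℚ_[p] i ∧ (fun i => PadicInt.toZMod (α i)) ⬝ᵥ v = 0 := by
  have htmul : ∀ a : Fin 3 → ℤ, (1 : ℚ_[p]) ⊗ₜ[ℚ] (∑ i, a i • e i) =
      ∑ i, (a i : ℤ_[p]) • e.baseChange ℚ_[p] i := by
    intro a
    rw [TensorProduct.tmul_sum]
    refine Finset.sum_congr rfl fun i _ => ?_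
    rw [TensorProduct.tmul_smul, Int.cast_smul_eq_zsmul, Basis.baseChange_apply]
  constructor
  · intro hy
    induction hy using Submodule.span_induction with
    | mem x hx =>
      obtain ⟨_, ⟨a, rfl, ha⟩, rfl⟩ := hx
      exact ⟨fun i => a i, htmul a, by simpa using ha⟩
    | zero => exact ⟨0, by simp, by simp [dotProduct]⟩
    | add x y _ _ hx hy =>
      obtain ⟨α, rfl, hα⟩ := hx
      obtain ⟨β, rfl, hβ⟩ := hy
      refine ⟨α + β, by simp [add_smul, Finset.sum_add_distrib], ?_⟩
      have : (fun i => PadicInt.toZMod ((α + β) i)) =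
          (fun i => PadicInt.toZMod (α i)) + fun i => PadicInt.toZMod (β i) := by
        ext i; simp
      rw [this, add_dotProduct, hα, hβ, add_zero]
    | smul c x _ hx =>
      obtain ⟨α, rfl, hα⟩ := hx
      refine ⟨c • α, by simp [Finset.smul_sum, smul_smul], ?_⟩
      have : (fun i => PadicInt.toZMod ((c • α) i)) =
          PadicInt.toZMod c • fun i => PadicInt.toZMod (α i) := by
        ext i; simp
      rw [this, smul_dotProduct, hα, smul_zero]
  · rintro ⟨α, rfl, hα⟩
    choose a β hβ using fun i => exists_int_sub_eq_pow_mul 1 (α i)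
    have ha : ∀ i, PadicInt.toZMod (α i) = (a i : ZMod p) := by
      intro i; rw [hβ i]; simp
    have h1 : ∑ i, α i • e.baseChange ℚ_[p] i = (1 : ℚ_[p]) ⊗ₜ[ℚ] (∑ i, a i • e i) +
        ∑ i, β i • ((1 : ℚ_[p]) ⊗ₜ[ℚ] ((p : ℤ) • e i)) := by
      rw [htmul, ← Finset.sum_add_distrib]
      refine Finset.sum_congr rfl fun i _ => ?_
      rw [TensorProduct.tmul_smul, ← Int.cast_smul_eq_zsmul ℤ_[p], smul_smul,
        ← Basis.baseChange_apply, ← add_smul]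
      congr 1
      rw [hβ i]; push_cast; ring
    rw [h1]
    refine Submodule.add_mem _ (Submodule.subset_span ⟨_, ⟨a, rfl, ?_⟩, rfl⟩)
      (Submodule.sum_mem _ fun i _ => Submodule.smul_mem _ _ (Submodule.subset_span
        ⟨_, smul_mem_congruenceSublattice e v (Submodule.subset_span (Set.mem_range_self i)), rfl⟩))
    rwa [← funext ha]

lemma mapMatrix_transpose_mul {R S : Type*} [CommRing R] [CommRing S] (φ : R →+* S)
    {A : Matrix (Fin 3) (Fin 3) R} (hA : Aᵀ * A = 1) : (A.map φ)ᵀ * A.map φ = 1 := by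
  rw [← Matrix.transpose_map, ← Matrix.map_mul, hA, Matrix.map_one _ (map_zero _) (map_one _)]

lemma map_mulVec_eq {R S : Type*} [CommRing R] [CommRing S] (φ : R →+* S)
    (A : Matrix (Fin 3) (Fin 3) R) (x : Fin 3 → R) :
    (fun i => φ ((A *ᵥ x) i)) = A.map φ *ᵥ fun i => φ (x i) := by
  ext i
  exact congrFun (RingHom.map_mulVec φ A x i |> fun h => funext fun _ : Unit => h) ()

lemma exists_isometry_image_completion {p : ℕ} [Fact p.Prime] {B : LinearMap.BilinForm ℚ V}
    {e : Basis (Fin 3) ℚ V} (he : gram B e = 1) {R : Matrix (Fin 3) (Fin 3) ℤ_[p]}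
    (hR : Rᵀ * R = 1) (v : Fin 3 → ZMod p) :
    ∃ σ : (B.baseChange ℚ_[p]).IsometryEquiv (B.baseChange ℚ_[p]),
      σ '' (completion p (congruenceSublattice e v) : Set (ℚ_[p] ⊗[ℚ] V)) =
        completion p (congruenceSublattice e (R.map PadicInt.toZMod *ᵥ v)) := by
  have hgram : gram (B.baseChange ℚ_[p]) (e.baseChange ℚ_[p]) = 1 := by
    rw [gram_baseChange, he, Matrix.map_one _ (map_zero _) (map_one _)]
  let σ := orthogonalIsometry (e.baseChange ℚ_[p]) hgram (R.map (algebraMap ℤ_[p] ℚ_[p]))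
    (mapMatrix_transpose_mul _ hR)
  have hσ : ∀ α : Fin 3 → ℤ_[p], σ (∑ i, α i • e.baseChange ℚ_[p] i) =
      ∑ i, (R *ᵥ α) i • e.baseChange ℚ_[p] i := by
    intro α
    simp only [← algebraMap_smul ℚ_[p] (_ : ℤ_[p]) (_ : ℚ_[p] ⊗[ℚ] V)]
    rw [isometry_sum]
    simp only [σ, orthogonalIsometry_apply, Finset.smul_sum, smul_smul]
    rw [Finset.sum_comm]
    refine Finset.sum_congr rfl fun i _ => ?_
    rw [← Finset.sum_smul]
    congr 1
    simp only [mulVec, dotProduct, map_sum, map_mul, Matrix.map_apply]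
    exact Finset.sum_congr rfl fun j _ => mul_comm _ _
  have hR' : R * Rᵀ = 1 := mul_eq_one_comm.1 hR
  refine ⟨σ, ?_⟩
  ext y
  simp only [Set.mem_image, SetLike.mem_coe, mem_completion_congruenceSublattice]
  constructor
  · rintro ⟨_, ⟨α, rfl, hα⟩, rfl⟩
    refine ⟨R *ᵥ α, hσ α, ?_⟩
    rw [map_mulVec_eq, transpose_mulVec_dotProduct_mulVec (mapMatrix_transpose_mul _ hR), hα]
  · rintro ⟨α, rfl, hα⟩
    refine ⟨_, ⟨Rᵀ *ᵥ α, rfl, ?_⟩, ?_⟩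
    · rw [map_mulVec_eq, ← hα, dotProduct_mulVec, ← mulVec_transpose, Matrix.transpose_map]
    · rw [hσ, mulVec_mulVec, hR', one_mulVec]

/-- The reflection along any lift `u` of `w - v` works: `u ⬝ᵥ u` reduces to `2(1 - v ⬝ᵥ w)`, hence
is a unit, so the reflection is integral over `ℤ_p` and exactly orthogonal. -/
lemma exists_reflection {p : ℕ} [Fact p.Prime] {v w : Fin 3 → ZMod p} (hv : v ⬝ᵥ v = 1)
    (hw : w ⬝ᵥ w = 1) (hvw : 1 - v ⬝ᵥ w ≠ 0) (h2 : (2 : ZMod p) ≠ 0) :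
    ∃ R : Matrix (Fin 3) (Fin 3) ℤ_[p], Rᵀ * R = 1 ∧ R.map PadicInt.toZMod *ᵥ v = w := by
  have hsurj : Function.Surjective (PadicInt.toZMod (p := p)) := ZMod.ringHom_surjective _
  choose u hu using fun i => hsurj (w i - v i)
  have hu' : (fun i => PadicInt.toZMod (u i)) = w - v := funext hu
  have huu : PadicInt.toZMod (u ⬝ᵥ u) = 2 * (1 - v ⬝ᵥ w) := by
    have : PadicInt.toZMod (u ⬝ᵥ u) = (w - v) ⬝ᵥ (w - v) := by
      rw [← hu']; simp [dotProduct]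
    rw [this, sub_dotProduct, dotProduct_sub, dotProduct_sub, hv, hw, dotProduct_comm w v]
    ring
  have hunit : IsUnit (u ⬝ᵥ u) := by
    by_contra h
    have h1 : u ⬝ᵥ u ∈ IsLocalRing.maximalIdeal ℤ_[p] := (IsLocalRing.mem_maximalIdeal _).2 h
    rw [← PadicInt.ker_toZMod, RingHom.mem_ker, huu] at h1
    exact mul_ne_zero h2 hvw h1
  obtain ⟨c, hc⟩ := hunit.exists_left_inv
  refine ⟨1 - (2 * c) • vecMulVec u u, ?_, ?_⟩
  · have hT : (1 - (2 * c) • vecMulVec u u)ᵀ = 1 - (2 * c) • vecMulVec u u := by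
      simp [transpose_vecMulVec]
    have hsq : vecMulVec u u * vecMulVec u u = (u ⬝ᵥ u) • vecMulVec u u := by
      rw [vecMulVec_mul_vecMulVec]
      ext i j; simp [vecMulVec_apply]; ring
    rw [hT]
    simp only [sub_mul, mul_sub, Matrix.one_mul, Matrix.mul_one, smul_mul_assoc, mul_smul_comm,
      hsq, smul_smul]
    rw [show 2 * c * (u ⬝ᵥ u) = 2 by linear_combination 2 * hc, two_smul]
    simp
  · have hcz : PadicInt.toZMod c * (2 * (1 - v ⬝ᵥ w)) = 1 := by
      rw [← huu, ← map_mul, hc, map_one]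
    ext i
    have h3 : ∑ j, (w j - v j) * v j = v ⬝ᵥ w - 1 := by
      rw [← hv]; simp only [dotProduct, ← Finset.sum_sub_distrib]
      exact Finset.sum_congr rfl fun j _ => by ring
    have h4 : ((1 - (2 * c) • vecMulVec u u).map PadicInt.toZMod *ᵥ v) i =
        v i - 2 * PadicInt.toZMod c * (w i - v i) * ∑ j, (w j - v j) * v j := by
      have : ((1 - (2 * c) • vecMulVec u u).map PadicInt.toZMod) =
          1 - (2 * PadicInt.toZMod c) • vecMulVec (w - v) (w - v) := by
        have hz : PadicInt.toZMod (2 : ℤ_[p]) = 2 := map_ofNat _ 2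
        ext i j
        by_cases h : i = j <;> simp [vecMulVec_apply, hu, h, hz]
      rw [this, sub_mulVec, one_mulVec, Pi.sub_apply, smul_mulVec, Pi.smul_apply, smul_eq_mul,
        vecMulVec_mulVec]
      simp [dotProduct]
      ring
    rw [h4, h3]
    linear_combination (w i - v i) * hcz

/-- Away from `p` both lattices complete to the full lattice. At `p` a reflection takes `v` to `w`,
or to `-w` when `v ⬝ᵥ w = 1`; the lattice does not see the sign. -/
theorem congruenceSublattice_mem_genus {p : ℕ} [Fact p.Prime] (hp : p ≠ 2)
    {B : LinearMap.BilinForm ℚ V} {e : Basis (Fin 3) ℚ V} (he : gram B e = 1)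
    {v w : Fin 3 → ZMod p} (hv : v ⬝ᵥ v = 1) (hw : w ⬝ᵥ w = 1) :
    congruenceSublattice e w ∈ genus B (congruenceSublattice e v) := by
  refine ⟨isLattice_congruenceSublattice e w, fun q _ => ?_⟩
  by_cases hpq : q = p
  · subst hpq
    have h2 := two_ne_zero_zmod hp
    obtain ⟨R, hR, h⟩ : ∃ R : Matrix (Fin 3) (Fin 3) ℤ_[q], Rᵀ * R = 1 ∧
        (R.map PadicInt.toZMod *ᵥ v = w ∨ R.map PadicInt.toZMod *ᵥ v = -w) := by
      by_cases hvw : 1 - v ⬝ᵥ w = 0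
      · obtain ⟨R, hR, h⟩ := exists_reflection (w := -w) hv (by simp [hw]) (by
          rw [dotProduct_neg]
          intro h
          exact h2 (by linear_combination h + hvw)) h2
        exact ⟨R, hR, Or.inr h⟩
      · obtain ⟨R, hR, h⟩ := exists_reflection hv hw hvw h2
        exact ⟨R, hR, Or.inl h⟩
    obtain ⟨σ, hσ⟩ := exists_isometry_image_completion he hR v
    refine ⟨σ, ?_⟩
    rw [hσ]
    rcases h with h | h <;> rw [h]
    rw [congruenceSublattice_neg]
  · rw [completion_congruenceSublattice_of_ne hpq, completion_congruenceSublattice_of_ne hpq]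
    exact ⟨LinearMap.BilinForm.IsometryEquiv.refl _, Set.image_id _⟩

end

section

variable {V : Type*} [AddCommGroup V] [Module ℚ V]

/-! ### The action of `O₃(ℤ)` on the unit sphere modulo `p` -/

/-- The vectors of norm `1` in `𝔽_p³`. -/
abbrev UnitSphere (p : ℕ) : Type := {v : Fin 3 → ZMod p // v ⬝ᵥ v = 1}

lemma transpose_mul_of_mem (A : orthogonalGroup (Fin 3) ℤ) :
    (A : Matrix (Fin 3) (Fin 3) ℤ)ᵀ * A = 1 :=
  (mem_orthogonalGroup_iff' _ _).1 A.2

instance (p : ℕ) : MulAction (orthogonalGroup (Fin 3) ℤ) (UnitSphere p) where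
  smul A v := ⟨(A : Matrix (Fin 3) (Fin 3) ℤ).map (Int.castRingHom (ZMod p)) *ᵥ v, by
    rw [transpose_mulVec_dotProduct_mulVec
      (mapMatrix_transpose_mul _ (transpose_mul_of_mem A)), v.2]⟩
  one_smul v := Subtype.ext <| by
    change ((1 : Matrix (Fin 3) (Fin 3) ℤ).map (Int.castRingHom (ZMod p))) *ᵥ v.1 = v.1
    rw [Matrix.map_one _ (map_zero _) (map_one _), one_mulVec]
  mul_smul A C v := Subtype.ext <| by
    change ((A * C : Matrix (Fin 3) (Fin 3) ℤ).map (Int.castRingHom (ZMod p))) *ᵥ v.1 =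
      (A : Matrix (Fin 3) (Fin 3) ℤ).map (Int.castRingHom (ZMod p)) *ᵥ
        ((C : Matrix (Fin 3) (Fin 3) ℤ).map (Int.castRingHom (ZMod p)) *ᵥ v.1)
    rw [Matrix.map_mul, mulVec_mulVec]

lemma coe_smul_unitSphere {p : ℕ} (A : orthogonalGroup (Fin 3) ℤ) (v : UnitSphere p) :
    ((A • v : UnitSphere p) : Fin 3 → ZMod p) =
      (A : Matrix (Fin 3) (Fin 3) ℤ).map (Int.castRingHom (ZMod p)) *ᵥ v.1 := rfl

lemma coe_neg_smul_unitSphere {p : ℕ} (A : orthogonalGroup (Fin 3) ℤ) (v : UnitSphere p) :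
    ((-A • v : UnitSphere p) : Fin 3 → ZMod p) = -(A • v : UnitSphere p).1 := by
  rw [coe_smul_unitSphere, coe_smul_unitSphere,
    show ((-A : orthogonalGroup (Fin 3) ℤ) : Matrix (Fin 3) (Fin 3) ℤ) = -A.1 from rfl]
  ext i
  simp [mulVec, dotProduct]

/-! ### Isometries of congruence sublattices -/

section

variable {p : ℕ} {B : LinearMap.BilinForm ℚ V} {e : Basis (Fin 3) ℚ V}

lemma isometry_sum_eq_mulVec {σ : B.IsometryEquiv B} {A : Matrix (Fin 3) (Fin 3) ℤ}
    (hσ : ∀ j, σ (e j) = ∑ i, A i j • e i) (a : Fin 3 → ℤ) :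
    σ (∑ i, a i • e i) = ∑ i, (A *ᵥ a) i • e i := by
  rw [isometry_zsum]
  simp only [hσ, Finset.smul_sum, smul_smul]
  rw [Finset.sum_comm]
  refine Finset.sum_congr rfl fun i _ => ?_
  rw [← Finset.sum_smul]
  congr 1
  exact Finset.sum_congr rfl fun j _ => mul_comm _ _

lemma image_congruenceSublattice {σ : B.IsometryEquiv B} {A : orthogonalGroup (Fin 3) ℤ}
    (hσ : ∀ j, σ (e j) = ∑ i, (A : Matrix (Fin 3) (Fin 3) ℤ) i j • e i) (v : UnitSphere p) :
    σ '' (congruenceSublattice e v.1 : Set V) = congruenceSublattice e (A • v).1 := by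
  have hA := transpose_mul_of_mem A
  have hA' : (A : Matrix (Fin 3) (Fin 3) ℤ) * (A : Matrix (Fin 3) (Fin 3) ℤ)ᵀ = 1 :=
    mul_eq_one_comm.1 hA
  rw [coe_smul_unitSphere]
  ext y
  simp only [Set.mem_image, SetLike.mem_coe, mem_congruenceSublattice]
  constructor
  · rintro ⟨_, ⟨a, rfl, ha⟩, rfl⟩
    refine ⟨A *ᵥ a, isometry_sum_eq_mulVec hσ a, ?_⟩
    have := map_mulVec_eq (Int.castRingHom (ZMod p)) A a
    simp only [eq_intCast] at this
    rw [this, transpose_mulVec_dotProduct_mulVec (mapMatrix_transpose_mul _ hA), ha]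
  · rintro ⟨a, rfl, ha⟩
    refine ⟨_, ⟨(A : Matrix (Fin 3) (Fin 3) ℤ)ᵀ *ᵥ a, rfl, ?_⟩, ?_⟩
    · have := map_mulVec_eq (Int.castRingHom (ZMod p)) (A : Matrix (Fin 3) (Fin 3) ℤ)ᵀ a
      simp only [eq_intCast] at this
      rw [this, ← ha, dotProduct_mulVec, ← mulVec_transpose, Matrix.transpose_map]
    · rw [isometry_sum_eq_mulVec hσ, mulVec_mulVec, hA', one_mulVec]

/-- The isometry of `V` with matrix `A ∈ O₃(ℤ)` in an orthonormal basis. -/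
noncomputable def integralIsometry (he : gram B e = 1) (A : orthogonalGroup (Fin 3) ℤ) :
    B.IsometryEquiv B :=
  orthogonalIsometry e he ((A : Matrix (Fin 3) (Fin 3) ℤ).map (Int.castRingHom ℚ))
    (mapMatrix_transpose_mul _ (transpose_mul_of_mem A))

lemma integralIsometry_apply (he : gram B e = 1) (A : orthogonalGroup (Fin 3) ℤ) (j : Fin 3) :
    integralIsometry he A (e j) = ∑ i, (A : Matrix (Fin 3) (Fin 3) ℤ) i j • e i := by
  rw [integralIsometry, orthogonalIsometry_apply]
  simp [Int.cast_smul_eq_zsmul]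

lemma integralIsometry_injective (he : gram B e = 1) :
    Function.Injective (integralIsometry he) := by
  intro A C h
  ext i j
  have h1 := integralIsometry_apply he A j
  rw [h, integralIsometry_apply] at h1
  exact (congrFun (sum_zsmul_injective e h1) i).symm

lemma exists_eq_integralIsometry (he : gram B e = 1) (σ : B.IsometryEquiv B)
    (h : ∀ j, σ (e j) ∈ Submodule.span ℤ (Set.range e)) :
    ∃ A : orthogonalGroup (Fin 3) ℤ, σ = integralIsometry he A := by
  choose a ha using fun j => mem_span_range_basis.1 (h j)
  let A : Matrix (Fin 3) (Fin 3) ℤ := Matrix.of fun i j => a j i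
  have hσ : ∀ j, σ (e j) = ∑ i, (A.map (Int.castRingHom ℚ)) i j • e i := by
    intro j; rw [ha j]; simp [A, Int.cast_smul_eq_zsmul]
  have hA : Aᵀ * A = 1 := by
    have h1 := gram_of_eq_sum B hσ
    have h2 : gram B (fun j => σ (e j)) = 1 := by
      rw [← he]; ext i j; simp [gram_apply, LinearMap.BilinForm.IsometryEquiv.map_app]
    rw [h2, he, Matrix.mul_one, ← Matrix.transpose_map, ← Matrix.map_mul] at h1
    apply Matrix.map_injective (f := Int.castRingHom ℚ) (RingHom.injective_int _)
    exact h1.symm.trans (Matrix.map_one _ (map_zero _) (map_one _)).symm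
  refine ⟨⟨A, (mem_orthogonalGroup_iff' _ _).2 hA⟩, ?_⟩
  apply DFunLike.ext
  intro x
  rw [← e.sum_repr x, isometry_sum, isometry_sum]
  refine Finset.sum_congr rfl fun j _ => ?_
  rw [integralIsometry_apply, ha j]
  rfl

lemma apply_mem_watson {m : ℕ} {σ : B.IsometryEquiv B} {M M' : Submodule ℤ V}
    (h : σ '' (M : Set V) = M') {x : V} (hx : x ∈ watson B m M) : σ x ∈ watson B m M' := by
  obtain ⟨hxM, hx'⟩ := hx
  refine ⟨by rw [← SetLike.mem_coe, ← h]; exact ⟨x, hxM, rfl⟩, fun y hy => ?_⟩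
  rw [← SetLike.mem_coe, ← h] at hy
  obtain ⟨z, hz, rfl⟩ := hy
  obtain ⟨k, hk⟩ := hx' z hz
  refine ⟨k, ?_⟩
  rw [← map_add, LinearMap.BilinForm.IsometryEquiv.map_app,
    LinearMap.BilinForm.IsometryEquiv.map_app, hk]

variable [Fact p.Prime]

/-- Isometries respect Watson transforms, and both lattices have the same one, `p` times the span of
`e`. So the isometry maps that span into itself. -/
lemma exists_eq_integralIsometry_of_image_eq (hp : p ≠ 2) (he : gram B e = 1)
    {v w : UnitSphere p} {σ : B.IsometryEquiv B}
    (h : σ '' (congruenceSublattice e v.1 : Set V) = congruenceSublattice e w.1) :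
    ∃ A : orthogonalGroup (Fin 3) ℤ, σ = integralIsometry he A := by
  have hp0 : (p : ℚ) ≠ 0 := by exact_mod_cast (Fact.out : p.Prime).ne_zero
  refine exists_eq_integralIsometry he σ fun j => ?_
  have h1 : scaledBasis (primeUnit p) e j ∈ watson B p (congruenceSublattice e v.1) := by
    rw [watson_congruenceSublattice hp he v.2]
    exact Submodule.subset_span (Set.mem_range_self j)
  have h2 := apply_mem_watson h h1
  rw [watson_congruenceSublattice hp he w.2] at h2
  obtain ⟨a, ha⟩ := mem_span_range_basis.1 h2
  refine mem_span_range_basis.2 ⟨a, ?_⟩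
  have h3 : (p : ℚ) • σ (e j) = (p : ℚ) • ∑ i, a i • e i := by
    rw [← map_smul]
    rw [scaledBasis_apply] at ha
    refine Eq.trans ha ?_
    rw [Finset.smul_sum]
    exact Finset.sum_congr rfl fun i _ => by rw [scaledBasis_apply, smul_comm]; rfl
  exact smul_right_injective V hp0 h3

/-- The lattice determines the hyperplane `v^⊥` over `𝔽_p`, hence the line of `v`, and norm 1 leaves
only the sign. -/
lemma eq_or_eq_neg_of_congruenceSublattice_eq {v w : UnitSphere p}
    (h : congruenceSublattice e v.1 = congruenceSublattice e w.1) : w.1 = v.1 ∨ w.1 = -v.1 := by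
  have key : ∀ β : Fin 3 → ZMod p, β ⬝ᵥ v.1 = 0 → β ⬝ᵥ w.1 = 0 := by
    intro β hβ
    choose b hb using fun i => ZMod.intCast_surjective (β i)
    obtain rfl : (fun i => (b i : ZMod p)) = β := funext hb
    rw [← sum_mem_congruenceSublattice (f := e), ← h, sum_mem_congruenceSublattice]
    exact hβ
  have hw : w.1 = (v.1 ⬝ᵥ w.1) • v.1 := by
    ext i
    have := key (Pi.single i 1 - v.1 i • v.1) (by
      rw [sub_dotProduct, smul_dotProduct, v.2]; simp)
    rw [sub_dotProduct, smul_dotProduct, single_one_dotProduct] at this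
    rw [Pi.smul_apply, smul_eq_mul, mul_comm]
    exact sub_eq_zero.1 this
  have hc : (v.1 ⬝ᵥ w.1) * (v.1 ⬝ᵥ w.1) = 1 := by
    have := w.2
    rw [hw, smul_dotProduct, dotProduct_smul, v.2] at this
    simpa using this
  rcases mul_self_eq_one_iff.1 hc with h1 | h1
  · left; rw [hw, h1, one_smul]
  · right; rw [hw, h1, neg_one_smul]

lemma exists_smul_eq_of_eq_or_eq_neg {A : orthogonalGroup (Fin 3) ℤ} {v w : UnitSphere p}
    (h : (A • v).1 = w.1 ∨ (A • v).1 = -w.1) : ∃ C : orthogonalGroup (Fin 3) ℤ, C • v = w := by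
  rcases h with h | h
  · exact ⟨A, Subtype.ext h⟩
  · exact ⟨-A, Subtype.ext (by rw [coe_neg_smul_unitSphere, h, neg_neg])⟩

/-- Congruence sublattices are in the same class exactly when their vectors are in one orbit. -/
theorem latticeClass_congruenceSublattice_eq_iff (hp : p ≠ 2) (he : gram B e = 1)
    {v w : UnitSphere p} :
    latticeClass B (congruenceSublattice e v.1) = latticeClass B (congruenceSublattice e w.1) ↔
      v ∈ MulAction.orbit (orthogonalGroup (Fin 3) ℤ) w := by
  rw [latticeClass_eq_iff, MulAction.mem_orbit_symm]
  constructor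
  · rintro ⟨σ, hσ⟩
    obtain ⟨A, rfl⟩ := exists_eq_integralIsometry_of_image_eq hp he hσ
    rw [image_congruenceSublattice (integralIsometry_apply he A)] at hσ
    have := eq_or_eq_neg_of_congruenceSublattice_eq (SetLike.coe_injective hσ)
    -- The sign ambiguity is absorbed by `-1 ∈ O₃(ℤ)`.
    apply exists_smul_eq_of_eq_or_eq_neg (A := A)
    rcases this with h | h
    · exact Or.inl h.symm
    · exact Or.inr (by rw [h, neg_neg])
  · rintro ⟨A, hA⟩
    refine ⟨integralIsometry he A, ?_⟩
    rw [image_congruenceSublattice (integralIsometry_apply he A)]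
    rw [show A • v = w from hA]

/-- The isometries of the lattice are the `A ∈ O₃(ℤ)` with `A v = ± v`. Since `v ≠ -v`, negation
matches the two signs, which gives the factor 2. -/
theorem isometryOrder_congruenceSublattice (hp : p ≠ 2) (he : gram B e = 1) (v : UnitSphere p) :
    isometryOrder B (congruenceSublattice e v.1) =
      2 * Nat.card (MulAction.stabilizer (orthogonalGroup (Fin 3) ℤ) v) := by
  have hv0 : v.1 ≠ -v.1 := by
    intro h
    have h1 : (2 : ZMod p) * (v.1 ⬝ᵥ v.1) = 0 := by
      have : v.1 ⬝ᵥ v.1 = -(v.1 ⬝ᵥ v.1) := by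
        conv_lhs => rw [h]
        rw [neg_dotProduct, dotProduct_neg, neg_neg, ← neg_dotProduct, ← h]
      linear_combination this
    rw [v.2, mul_one] at h1
    exact two_ne_zero_zmod hp h1
  let S := MulAction.stabilizer (orthogonalGroup (Fin 3) ℤ) v
  have himg : ∀ A : orthogonalGroup (Fin 3) ℤ,
      integralIsometry he A '' (congruenceSublattice e v.1 : Set V) = congruenceSublattice e v.1 ↔
        ((A • v).1 = v.1 ∨ (A • v).1 = -v.1) := by
    intro A
    rw [image_congruenceSublattice (integralIsometry_apply he A)]
    constructor
    · intro h
      exact eq_or_eq_neg_of_congruenceSublattice_eq (SetLike.coe_injective h.symm)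
    · rintro (h | h) <;> rw [h]
      rw [congruenceSublattice_neg]
  let φ : Bool × S → {σ : B.IsometryEquiv B // σ '' (congruenceSublattice e v.1 : Set V) =
      congruenceSublattice e v.1} := fun x =>
    ⟨integralIsometry he (if x.1 then -x.2.1 else x.2.1), (himg _).2 (by
      have h : x.2.1 • v = v := x.2.2
      by_cases hx : x.1 = true
      · rw [if_pos hx, coe_neg_smul_unitSphere, h]; exact Or.inr rfl
      · rw [if_neg hx, h]; exact Or.inl rfl)⟩
  have hφ : Function.Bijective φ := by
    constructor
    · rintro ⟨s, A, hA⟩ ⟨t, C, hC⟩ h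
      have h1 := integralIsometry_injective he (congrArg Subtype.val h)
      have hA' : A • v = v := hA
      have hC' : C • v = v := hC
      cases s <;> cases t <;> simp only [if_true, if_false, Bool.false_eq_true] at h1
      · subst h1; rfl
      · exfalso
        apply hv0
        conv_lhs => rw [← hA', h1, coe_neg_smul_unitSphere, hC']
      · exfalso
        apply hv0
        conv_lhs => rw [← hC', ← h1, coe_neg_smul_unitSphere, hA']
      · rw [neg_inj] at h1; subst h1; rfl
    · rintro ⟨σ, hσ⟩
      obtain ⟨A, rfl⟩ := exists_eq_integralIsometry_of_image_eq hp he hσ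
      rcases (himg A).1 hσ with h | h
      · exact ⟨(false, ⟨A, Subtype.ext h⟩), rfl⟩
      · refine ⟨(true, ⟨-A, Subtype.ext ?_⟩), ?_⟩
        · rw [coe_neg_smul_unitSphere, h, neg_neg]
        · apply Subtype.ext
          simp [φ]
  rw [isometryOrder, ← Nat.card_congr (Equiv.ofBijective φ hφ), Nat.card_prod]
  simp [S]

end

end

section

variable {V : Type*} [AddCommGroup V] [Module ℚ V]

lemma image_congruenceSublattice_of_bases {p : ℕ}
    {B : LinearMap.BilinForm ℚ V} {f g : Basis (Fin 3) ℚ V} {σ : B.IsometryEquiv B}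
    (h : ∀ i, σ (f i) = g i) (v : Fin 3 → ZMod p) :
    σ '' (congruenceSublattice f v : Set V) = congruenceSublattice g v := by
  ext x
  simp only [Set.mem_image, SetLike.mem_coe, mem_congruenceSublattice]
  constructor
  · rintro ⟨_, ⟨a, rfl, ha⟩, rfl⟩
    exact ⟨a, by simp only [isometry_zsum, h], ha⟩
  · rintro ⟨a, rfl, ha⟩
    exact ⟨_, ⟨a, rfl, ha⟩, by simp only [isometry_zsum, h]⟩

/-! ### Class numbers as numbers of orbits -/

/-- The orbit of a vector of norm `1` modulo `p` under `O₃(ℤ)`. -/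
abbrev orbitClass (p : ℕ) (v : UnitSphere p) :
    MulAction.orbitRel.Quotient (orthogonalGroup (Fin 3) ℤ) (UnitSphere p) :=
  Quotient.mk (MulAction.orbitRel (orthogonalGroup (Fin 3) ℤ) (UnitSphere p)) v

variable {p : ℕ} [Fact p.Prime] {B : LinearMap.BilinForm ℚ V} {e : Basis (Fin 3) ℚ V}

/-- The class of a congruence sublattice factors through the orbit of its vector, and the induced
map on orbits is injective. -/
lemma ncard_image_latticeClass (hp : p ≠ 2) (he : gram B e = 1) (S : Set (UnitSphere p)) :
    ((fun v : UnitSphere p => latticeClass B (congruenceSublattice e v.1)) '' S).ncard =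
      (orbitClass p '' S).ncard := by
  let Φ : MulAction.orbitRel.Quotient (orthogonalGroup (Fin 3) ℤ) (UnitSphere p) →
      Set (Submodule ℤ V) :=
    Quotient.lift (fun v : UnitSphere p => latticeClass B (congruenceSublattice e v.1))
      fun v w h => (latticeClass_congruenceSublattice_eq_iff hp he).2 h
  have hΦ : Function.Injective Φ := by
    intro x y
    induction x using Quotient.inductionOn with | _ x => ?_
    induction y using Quotient.inductionOn with | _ y => ?_
    intro h
    exact Quotient.sound ((latticeClass_congruenceSublattice_eq_iff hp he).1 h)
  rw [← Set.ncard_image_of_injective _ hΦ, Set.image_image]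
  rfl

variable (hp : p ≠ 2) (hV : finrank ℚ V = 3) (hsymm : B.IsSymm)
  (hpos : ∀ x : V, x ≠ 0 → 0 < B x x) {L : Submodule ℤ V} (hL : L.IsLattice ℚ)
  (hprim : IsPrimitive B L) (hdisc : HasDiscriminant B L ((p : ℚ) ^ 2))
  (hloc : HasGram (B.baseChange ℚ_[p]) (completion p L)
    (Matrix.diagonal ![1, 1, (p : ℚ_[p]) ^ 2]))
  (he : gram B e = 1) {v₀ : Fin 3 → ZMod p} (hv₀ : v₀ ⬝ᵥ v₀ = 1)
  (hLe : L = congruenceSublattice e v₀)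

include hp hV hsymm hpos hL hprim hdisc hloc he hv₀ hLe

/-- A lattice in the genus lives in its own unimodular overlattice with orthonormal basis `f`; the
isometry from `f` to `e` moves it into the fixed one without changing its class. -/
lemma classNumber_eq_ncard_orbits :
    classNumber B L = (orbitClass p '' Set.univ).ncard := by
  rw [← ncard_image_latticeClass hp he, classNumber, numClasses]
  congr 1
  ext X
  simp only [Set.mem_image, Set.mem_univ, true_and]
  constructor
  · rintro ⟨M, hM, rfl⟩
    obtain ⟨f, hf, v, hv, rfl⟩ :=
      exists_eq_congruenceSublattice_of_mem_genus hV hsymm hpos hL hprim hdisc hloc hM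
    exact ⟨⟨v, hv⟩, (latticeClass_eq_of_image_eq _ (image_congruenceSublattice_of_bases
      (isometryOfBases_apply f e hf he) v)).symm⟩
  · rintro ⟨v, rfl⟩
    exact ⟨_, hLe ▸ congruenceSublattice_mem_genus hp he hv₀ v.2, rfl⟩

/-- Fixing the Watson transform fixes the unimodular overlattice, so `f` and `e` differ by an
element of `O₃(ℤ)`, which can be moved onto the vector. -/
lemma mem_watsonFiber_iff {M : Submodule ℤ V} :
    M ∈ watsonFiber B p L (watson B p L) ↔
      ∃ v : UnitSphere p, M = congruenceSublattice e v.1 := by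
  constructor
  · rintro ⟨hM, hw⟩
    obtain ⟨f, hf, v, hv, rfl⟩ :=
      exists_eq_congruenceSublattice_of_mem_genus hV hsymm hpos hL hprim hdisc hloc hM
    rw [hLe, watson_congruenceSublattice hp hf hv, watson_congruenceSublattice hp he hv₀,
      span_scaledBasis_eq_iff] at hw
    obtain ⟨A, hA⟩ := exists_eq_integralIsometry he (isometryOfBases e f he hf) fun j => by
      rw [isometryOfBases_apply, ← hw]
      exact Submodule.subset_span (Set.mem_range_self j)
    refine ⟨A • ⟨v, hv⟩, ?_⟩
    have h1 := image_congruenceSublattice (p := p) (integralIsometry_apply he A) ⟨v, hv⟩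
    rw [← hA, image_congruenceSublattice_of_bases (isometryOfBases_apply e f he hf)] at h1
    exact SetLike.coe_injective h1
  · rintro ⟨v, rfl⟩
    refine ⟨hLe ▸ congruenceSublattice_mem_genus hp he hv₀ v.2, ?_⟩
    rw [hLe, watson_congruenceSublattice hp he v.2, watson_congruenceSublattice hp he hv₀]

lemma fiberClasses_eq_ncard_orbits (n : ℕ) :
    fiberClasses B p L (watson B p L) n = (orbitClass p '' {v : UnitSphere p |
      2 * Nat.card (MulAction.stabilizer (orthogonalGroup (Fin 3) ℤ) v) = n}).ncard := by
  rw [← ncard_image_latticeClass hp he, fiberClasses, numClasses]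
  congr 1
  ext X
  simp only [Set.mem_image, Set.mem_ofPred_eq,
    mem_watsonFiber_iff hp hV hsymm hpos hL hprim hdisc hloc he hv₀ hLe]
  constructor
  · rintro ⟨_, ⟨⟨v, rfl⟩, hn⟩, rfl⟩
    exact ⟨v, by rw [← hn, isometryOrder_congruenceSublattice hp he], rfl⟩
  · rintro ⟨v, hn, rfl⟩
    exact ⟨_, ⟨⟨v, rfl⟩, by rw [← hn, isometryOrder_congruenceSublattice hp he]⟩, rfl⟩

end

section

/-! ### Signed permutation matrices -/

/-- The signed permutation matrix with entries `s j` at `(π j, j)`. -/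
def signedPerm (x : Equiv.Perm (Fin 3) × (Fin 3 → ℤˣ)) : orthogonalGroup (Fin 3) ℤ :=
  ⟨Matrix.of fun i j => if i = x.1 j then (x.2 j : ℤ) else 0, by
    rw [mem_orthogonalGroup_iff']
    ext j k
    by_cases h : j = k
    · subst h
      simpa [Matrix.mul_apply, ← sq] using Int.units_eq_one_or _
    · simp [Matrix.mul_apply, h, Ne.symm h]⟩

lemma signedPerm_apply (x : Equiv.Perm (Fin 3) × (Fin 3 → ℤˣ)) (i j : Fin 3) :
    (signedPerm x : Matrix (Fin 3) (Fin 3) ℤ) i j = if i = x.1 j then (x.2 j : ℤ) else 0 := rfl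

/-- A column of an integral orthogonal matrix is an integral vector of norm 1, so it has a single
nonzero entry, a unit; orthogonality puts these entries in different rows. -/
lemma signedPerm_bijective : Function.Bijective signedPerm := by
  constructor
  · rintro ⟨π, s⟩ ⟨π', s'⟩ h
    have h1 : ∀ j, (s j : ℤ) = if π j = π' j then (s' j : ℤ) else 0 := by
      intro j
      rw [← signedPerm_apply (π', s'), ← h, signedPerm_apply, if_pos rfl]
    have h2 : ∀ j, π j = π' j := by
      intro j
      by_contra hj
      have := h1 j
      rw [if_neg hj] at this
      exact (s j).ne_zero this
    refine Prod.ext (Equiv.ext h2) (funext fun j => Units.ext ?_)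
    rw [h1 j, if_pos (h2 j)]
  · rintro ⟨A, hA⟩
    rw [mem_orthogonalGroup_iff'] at hA
    have hcol : ∀ j k, ∑ i, A i j * A i k = if j = k then 1 else 0 := by
      intro j k
      have := congrFun (congrFun hA j) k
      simpa [Matrix.mul_apply, Matrix.one_apply] using this
    have hex : ∀ j, ∃ i, A i j ≠ 0 := by
      intro j
      by_contra! h
      have := hcol j j
      simp [h] at this
    choose π hπ using hex
    have hzero : ∀ i j, i ≠ π j → A i j = 0 := by
      intro i j hij
      have h1 : ∑ l ∈ {i, π j}, A l j * A l j ≤ 1 := by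
        have := hcol j j
        rw [if_pos rfl] at this
        rw [← this]
        exact Finset.sum_le_sum_of_subset_of_nonneg (Finset.subset_univ _)
          fun l _ _ => mul_self_nonneg _
      rw [Finset.sum_pair hij] at h1
      have h2 : 0 < A (π j) j * A (π j) j := mul_self_pos.2 (hπ j)
      have h3 := mul_self_nonneg (A i j)
      exact mul_self_eq_zero.1 (by omega)
    have hsum : ∀ j k, A (π j) j * A (π j) k = if j = k then 1 else 0 := by
      intro j k
      rw [← hcol j k, Finset.sum_eq_single (π j) (fun i _ hi => by rw [hzero i j hi, zero_mul])]
      simp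
    have hinj : Function.Injective π := by
      intro j k hjk
      by_contra h
      have := hsum j k
      rw [if_neg h] at this
      rcases mul_eq_zero.1 this with h1 | h1
      · exact hπ j h1
      · exact hπ k (hjk ▸ h1)
    have hu : ∀ j, IsUnit (A (π j) j) := by
      intro j
      have := hsum j j
      rw [if_pos rfl] at this
      exact IsUnit.of_mul_eq_one _ this
    refine ⟨(Equiv.ofBijective π (Finite.injective_iff_bijective.1 hinj), fun j => (hu j).unit), ?_⟩
    apply Subtype.ext
    ext i j
    rw [signedPerm_apply]
    by_cases h : i = π j
    · simp [h]
    · change _ = A i j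
      rw [hzero i j h]
      exact if_neg h

/-- The orthogonal group `O₃(ℤ)` as the set of signed permutations. -/
noncomputable def signedPermEquiv :
    Equiv.Perm (Fin 3) × (Fin 3 → ℤˣ) ≃ orthogonalGroup (Fin 3) ℤ :=
  Equiv.ofBijective signedPerm signedPerm_bijective

instance : Finite (orthogonalGroup (Fin 3) ℤ) := Finite.of_equiv _ signedPermEquiv

lemma card_orthogonalGroup : Nat.card (orthogonalGroup (Fin 3) ℤ) = 48 := by
  rw [← Nat.card_congr signedPermEquiv, Nat.card_eq_fintype_card]
  simp [Fintype.card_perm, Nat.factorial]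

lemma signedPerm_smul_apply {p : ℕ} (x : Equiv.Perm (Fin 3) × (Fin 3 → ℤˣ)) (v : UnitSphere p)
    (j : Fin 3) : (signedPerm x • v).1 (x.1 j) = ((x.2 j : ℤ) : ZMod p) * v.1 j := by
  rw [coe_smul_unitSphere, mulVec, dotProduct, Finset.sum_eq_single j]
  · simp [signedPerm_apply]
  · intro k _ hk
    simp [signedPerm_apply, hk.symm]
  · simp

lemma signedPerm_smul_eq_iff {p : ℕ} (x : Equiv.Perm (Fin 3) × (Fin 3 → ℤˣ))
    (v w : UnitSphere p) :
    signedPerm x • v = w ↔ ∀ j, w.1 (x.1 j) = ((x.2 j : ℤ) : ZMod p) * v.1 j := by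
  constructor
  · rintro rfl j
    exact signedPerm_smul_apply x v j
  · intro h
    apply Subtype.ext
    funext i
    obtain ⟨j, rfl⟩ := x.1.surjective i
    rw [signedPerm_smul_apply, h]

lemma exists_unit_mul_eq_iff {p : ℕ} [Fact p.Prime] (a b : ZMod p) :
    (∃ s : ℤˣ, b = ((s : ℤ) : ZMod p) * a) ↔ b ^ 2 = a ^ 2 := by
  rw [sq_eq_sq_iff_eq_or_eq_neg]
  constructor
  · rintro ⟨s, rfl⟩
    rcases Int.units_eq_one_or s with rfl | rfl <;> simp
  · rintro (rfl | rfl)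
    · exact ⟨1, by simp⟩
    · exact ⟨-1, by simp⟩

/-- Signs can be chosen freely in each coordinate, so only squares up to permutation matter. -/
lemma mem_orbit_of_sq_eq {p : ℕ} [Fact p.Prime] {v w : UnitSphere p} (π : Equiv.Perm (Fin 3))
    (h : ∀ j, w.1 (π j) ^ 2 = v.1 j ^ 2) :
    w ∈ MulAction.orbit (orthogonalGroup (Fin 3) ℤ) v := by
  choose s hs using fun j => (exists_unit_mul_eq_iff _ _).2 (h j)
  exact ⟨signedPerm (π, s), (signedPerm_smul_eq_iff _ _ _).2 hs⟩

/-- Twice for zero, once for everything else. -/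
def zeroWeight {F : Type*} [Zero F] [DecidableEq F] (a : F) : ℕ := if a = 0 then 2 else 1

/-- The weight `1 + [a=b] + [a=c] + [b=c] + 2[a=b=c]`, the number of permutations of three indices
that preserve the triple `(a, b, c)`. -/
def coincidences {F : Type*} [DecidableEq F] (a b c : F) : ℕ :=
  1 + (if a = b then 1 else 0) + (if a = c then 1 else 0) + (if b = c then 1 else 0) +
    2 * (if a = b ∧ b = c then 1 else 0)

/-- Both signs work when both numbers are zero; otherwise at most one does, since `a ≠ -a` for `p`
odd. -/
lemma card_unit_mul_eq {p : ℕ} [Fact p.Prime] (hp : p ≠ 2) (a b : ZMod p) :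
    (Finset.univ.filter fun s : ℤˣ => b = ((s : ℤ) : ZMod p) * a).card =
      if a ^ 2 = b ^ 2 then zeroWeight a else 0 := by
  have hu : (Finset.univ : Finset ℤˣ) = {1, -1} := by decide
  have h2 := two_ne_zero_zmod hp
  rw [hu, Finset.filter_insert, Finset.filter_singleton]
  simp only [Units.val_one, Int.cast_one, one_mul, Units.val_neg, Int.cast_neg, neg_mul]
  by_cases ha : a = 0
  · subst ha
    by_cases hb : b = 0
    · subst hb; simp [zeroWeight]
    · have : ¬ (0 : ZMod p) = b ^ 2 := fun h => hb (pow_eq_zero_iff two_ne_zero |>.1 h.symm)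
      simp [hb, this]
  · have haa : a ≠ -a := by
      intro h
      exact mul_ne_zero h2 ha (by linear_combination h)
    have hiff : a ^ 2 = b ^ 2 ↔ b = a ∨ b = -a := by
      rw [eq_comm, sq_eq_sq_iff_eq_or_eq_neg]
    simp only [hiff]
    by_cases h : b = a
    · subst h; simp [zeroWeight, ha, haa]
    · by_cases h' : b = -a
      · subst h'
        simp [zeroWeight, ha, h]
      · simp [h, h']

/-- The six summands belong to the identity, the three transpositions and the two 3-cycles; each
tests whether the permutation preserves `(x, y, z)`. -/
lemma sum_perm_weights {F : Type*} [DecidableEq F] (x y z : F) (a b c : ℕ) :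
    a * b * c +
      (((if x = y then a else 0) * if y = x then b else 0) * c +
        (((if x = z then a else 0) * b * if z = x then c else 0) +
          (((a * if y = z then b else 0) * if z = y then c else 0) +
            ((((if x = y then a else 0) * if y = z then b else 0) * if z = x then c else 0) +
              ((if x = z then a else 0) * if y = x then b else 0) *
                if z = y then c else 0)))) = a * b * c * coincidences x y z := by
  simp only [coincidences, eq_comm (a := y) (b := x), eq_comm (a := z) (b := x),
    eq_comm (a := z) (b := y)]
  by_cases hxy : x = y
  · subst hxy
    by_cases hxz : x = z
    · subst hxz; simp; ring
    · simp [hxz]; ring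
  · by_cases hyz : y = z
    · subst hyz; simp [hxy]; ring
    · by_cases hxz : x = z
      · subst hxz; simp [hxy, hyz]; ring
      · simp [hxy, hyz, hxz]

/-- For a fixed permutation the signs are chosen independently in each coordinate, so its
contribution is a product, nonzero only if it preserves the squared coordinates. -/
theorem card_stabilizer {p : ℕ} [Fact p.Prime] (hp : p ≠ 2) (v : UnitSphere p) :
    Nat.card (MulAction.stabilizer (orthogonalGroup (Fin 3) ℤ) v) =
      zeroWeight (v.1 0) * zeroWeight (v.1 1) * zeroWeight (v.1 2) *
        coincidences (v.1 0 ^ 2) (v.1 1 ^ 2) (v.1 2 ^ 2) := by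
  have h1 : Nat.card (MulAction.stabilizer (orthogonalGroup (Fin 3) ℤ) v) =
      Nat.card (Σ π : Equiv.Perm (Fin 3),
        ∀ j, {s : ℤˣ // v.1 (π j) = ((s : ℤ) : ZMod p) * v.1 j}) := by
    refine (Nat.card_congr (Equiv.ofBijective (fun x =>
      ⟨signedPerm (x.1, fun j => (x.2 j).1), (signedPerm_smul_eq_iff _ _ _).2 fun j =>
        (x.2 j).2⟩) ⟨?_, ?_⟩)).symm
    · rintro ⟨π, s⟩ ⟨π', s'⟩ h
      have := signedPerm_bijective.1 (congrArg Subtype.val h)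
      simp only [Prod.mk.injEq] at this
      obtain ⟨rfl, hs⟩ := this
      congr 1
      funext j
      exact Subtype.ext (congrFun hs j)
    · rintro ⟨A, hA⟩
      obtain ⟨⟨π, s⟩, rfl⟩ := signedPerm_bijective.2 A
      exact ⟨⟨π, fun j => ⟨s j, (signedPerm_smul_eq_iff (π, s) v v).1 hA j⟩⟩, rfl⟩
  have h2 : ∀ π : Equiv.Perm (Fin 3),
      Nat.card (∀ j, {s : ℤˣ // v.1 (π j) = ((s : ℤ) : ZMod p) * v.1 j}) =
        ∏ j, if v.1 j ^ 2 = v.1 (π j) ^ 2 then zeroWeight (v.1 j) else 0 := by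
    intro π
    rw [Nat.card_pi]
    refine Finset.prod_congr rfl fun j _ => ?_
    rw [← card_unit_mul_eq hp, Nat.card_eq_fintype_card, Fintype.card_subtype]
  have hu : (Finset.univ : Finset (Equiv.Perm (Fin 3))) = {1, Equiv.swap 0 1, Equiv.swap 0 2,
      Equiv.swap 1 2, Equiv.swap 0 1 * Equiv.swap 1 2, Equiv.swap 1 2 * Equiv.swap 0 1} := by
    decide
  rw [h1, Nat.card_sigma]
  simp only [h2]
  rw [hu, Finset.sum_insert (by decide), Finset.sum_insert (by decide),
    Finset.sum_insert (by decide), Finset.sum_insert (by decide), Finset.sum_insert (by decide),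
    Finset.sum_singleton]
  have e1 : ∀ j : Fin 3, (Equiv.swap 0 1 : Equiv.Perm (Fin 3)) j = ![1, 0, 2] j := by decide
  have e2 : ∀ j : Fin 3, (Equiv.swap 0 2 : Equiv.Perm (Fin 3)) j = ![2, 1, 0] j := by decide
  have e3 : ∀ j : Fin 3, (Equiv.swap 1 2 : Equiv.Perm (Fin 3)) j = ![0, 2, 1] j := by decide
  have e4 : ∀ j : Fin 3, (Equiv.swap 0 1 * Equiv.swap 1 2 : Equiv.Perm (Fin 3)) j =
    ![1, 2, 0] j := by decide
  have e5 : ∀ j : Fin 3, (Equiv.swap 1 2 * Equiv.swap 0 1 : Equiv.Perm (Fin 3)) j =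
    ![2, 0, 1] j := by decide
  simp only [e1, e2, e3, e4, e5, Fin.prod_univ_three, Equiv.Perm.one_apply, Matrix.cons_val,
    if_true]
  exact sum_perm_weights _ _ _ _ _ _

end

section

/-! ### Orbits with a large stabilizer -/

section

variable {F : Type*} [Field F] [DecidableEq F] {x y z : F}

/-- The possible weights are 48 for three zeros, 8 for two, 4 or 2 for one (according to whether the
other squares agree), and 6, 2 or 1 for none. So each of 8, 6, 4 determines the configuration. -/
lemma eq_zero_of_weight_eq_eight
    (h : zeroWeight x * zeroWeight y * zeroWeight z * coincidences (x ^ 2) (y ^ 2) (z ^ 2) = 8) :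
    (y = 0 ∧ z = 0) ∨ (x = 0 ∧ z = 0) ∨ (x = 0 ∧ y = 0) := by
  by_cases hx : x = 0 <;> by_cases hy : y = 0 <;> by_cases hz : z = 0 <;>
    simp [hx, hy, hz, zeroWeight, coincidences, eq_comm (a := (0 : F))] at h ⊢ <;>
    split_ifs at h <;> omega

lemma sq_eq_sq_of_weight_eq_six
    (h : zeroWeight x * zeroWeight y * zeroWeight z * coincidences (x ^ 2) (y ^ 2) (z ^ 2) = 6) :
    x ^ 2 = y ^ 2 ∧ y ^ 2 = z ^ 2 := by
  by_cases hx : x = 0 <;> by_cases hy : y = 0 <;> by_cases hz : z = 0 <;>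
    simp [hx, hy, hz, zeroWeight, coincidences, eq_comm (a := (0 : F))] at h ⊢ <;>
    split_ifs at h <;> omega

lemma eq_zero_of_weight_eq_four
    (h : zeroWeight x * zeroWeight y * zeroWeight z * coincidences (x ^ 2) (y ^ 2) (z ^ 2) = 4) :
    (z = 0 ∧ x ^ 2 = y ^ 2) ∨ (y = 0 ∧ x ^ 2 = z ^ 2) ∨ (x = 0 ∧ y ^ 2 = z ^ 2) := by
  by_cases hx : x = 0 <;> by_cases hy : y = 0 <;> by_cases hz : z = 0 <;>
    simp [hx, hy, hz, zeroWeight, coincidences, eq_comm (a := (0 : F))] at h ⊢ <;>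
    split_ifs at h <;> first | omega | tauto

end

variable {p : ℕ} [Fact p.Prime]

lemma sum_sq_unitSphere (v : UnitSphere p) : v.1 0 ^ 2 + v.1 1 ^ 2 + v.1 2 ^ 2 = 1 := by
  have := v.2
  simp only [dotProduct, Fin.sum_univ_three] at this
  linear_combination this

/-- A point of the unit sphere given by its coordinates. -/
def spherePoint (x y z : ZMod p) (h : x ^ 2 + y ^ 2 + z ^ 2 = 1) : UnitSphere p :=
  ⟨![x, y, z], by
    simp only [dotProduct, Fin.sum_univ_three, Matrix.cons_val]
    linear_combination h⟩

omit [Fact p.Prime] in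
lemma ncard_image_orbitClass_eq_one {S : Set (UnitSphere p)} {v₀ : UnitSphere p} (h₀ : v₀ ∈ S)
    (h : ∀ v ∈ S, v ∈ MulAction.orbit (orthogonalGroup (Fin 3) ℤ) v₀) :
    (orbitClass p '' S).ncard = 1 := by
  rw [Set.ncard_eq_one]
  refine ⟨orbitClass p v₀, Set.eq_singleton_iff_unique_mem.2 ⟨⟨v₀, h₀, rfl⟩, ?_⟩⟩
  rintro _ ⟨v, hv, rfl⟩
  exact Quotient.sound (h v hv)

/-- The points of the unit sphere whose stabilizer in `O₃(ℤ)` has order `n`. -/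
def stabilizerOrder (p n : ℕ) : Set (UnitSphere p) :=
  {v | Nat.card (MulAction.stabilizer (orthogonalGroup (Fin 3) ℤ) v) = n}

lemma mem_stabilizerOrder (hp : p ≠ 2) {n : ℕ} {v : UnitSphere p} :
    v ∈ stabilizerOrder p n ↔ zeroWeight (v.1 0) * zeroWeight (v.1 1) * zeroWeight (v.1 2) *
        coincidences (v.1 0 ^ 2) (v.1 1 ^ 2) (v.1 2 ^ 2) = n := by
  rw [← card_stabilizer hp]; rfl

lemma ncard_orbits_stabilizerOrder_eight (hp : p ≠ 2) :
    (orbitClass p '' stabilizerOrder p 8).ncard = 1 := by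
  refine ncard_image_orbitClass_eq_one (v₀ := spherePoint 1 0 0 (by ring)) ?_ ?_
  · rw [mem_stabilizerOrder hp]
    simp [spherePoint, zeroWeight, coincidences]
  · intro v hv
    rw [mem_stabilizerOrder hp] at hv
    have hs := sum_sq_unitSphere v
    rcases eq_zero_of_weight_eq_eight hv with ⟨h1, h2⟩ | ⟨h1, h2⟩ | ⟨h1, h2⟩
    · rw [h1, h2] at hs
      refine mem_orbit_of_sq_eq 1 fun j => ?_
      fin_cases j <;> simp [spherePoint, h1, h2]
      simpa using hs
    · rw [h1, h2] at hs
      refine mem_orbit_of_sq_eq (Equiv.swap 0 1) fun j => ?_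
      fin_cases j <;> simp [spherePoint, h1, h2, Equiv.swap_apply_of_ne_of_ne]
      simpa using hs
    · rw [h1, h2] at hs
      refine mem_orbit_of_sq_eq (Equiv.swap 0 2) fun j => ?_
      fin_cases j <;> simp [spherePoint, h1, h2, Equiv.swap_apply_of_ne_of_ne]
      simpa using hs

lemma isSquare_of_mul_sq_eq_one {c x : ZMod p} (h : c * x ^ 2 = 1) : IsSquare c := by
  have hx : x ≠ 0 := by
    rintro rfl
    simp at h
  refine ⟨x⁻¹, ?_⟩
  field_simp
  linear_combination h

lemma exists_mul_sq_eq_one {c : ZMod p} (hc : c ≠ 0) (h : IsSquare c) : ∃ x, c * x ^ 2 = 1 := by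
  obtain ⟨y, rfl⟩ := h
  have hy : y ≠ 0 := fun h => hc (by rw [h, zero_mul])
  exact ⟨y⁻¹, by field_simp⟩

/-- Common pattern of the cases `c = 3` and `c = 2`: there is one orbit if `c x² = 1` is solvable,
that is if `c` is a square modulo `p`, and none otherwise. -/
lemma ncard_eq_of_legendreSym {n : ℕ} {c : ℤ} (hc : (c : ZMod p) ≠ 0) {S : Set (UnitSphere p)}
    (hS : ∀ v ∈ S, ∃ x : ZMod p, (c : ZMod p) * x ^ 2 = 1)
    (h : ∀ x : ZMod p, (c : ZMod p) * x ^ 2 = 1 → (orbitClass p '' S).ncard = 1)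
    (hn : (orbitClass p '' S).ncard = n) : (n : ℚ) = (1 + (legendreSym p c : ℚ)) / 2 := by
  by_cases hsq : IsSquare (c : ZMod p)
  · obtain ⟨x, hx⟩ := exists_mul_sq_eq_one hc hsq
    rw [(legendreSym.eq_one_iff p hc).2 hsq, ← hn, h x hx]
    norm_num
  · have hempty : S = ∅ := by
      rw [Set.eq_empty_iff_forall_notMem]
      intro v hv
      obtain ⟨x, hx⟩ := hS v hv
      exact hsq (isSquare_of_mul_sq_eq_one hx)
    rw [(legendreSym.eq_neg_one_iff p).2 hsq, ← hn, hempty]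
    simp

/-- All three squares equal `r²` with `3r² = 1`, which fixes `r²` and hence the orbit of `(r, r,
r)`. -/
lemma ncard_orbits_stabilizerOrder_six (hp : p ≠ 2) (h3 : ((3 : ℤ) : ZMod p) ≠ 0) :
    ((orbitClass p '' stabilizerOrder p 6).ncard : ℚ) = (1 + (legendreSym p 3 : ℚ)) / 2 := by
  have key : ∀ v ∈ stabilizerOrder p 6, v.1 0 ^ 2 = v.1 1 ^ 2 ∧ v.1 1 ^ 2 = v.1 2 ^ 2 := by
    intro v hv
    rw [mem_stabilizerOrder hp] at hv
    exact sq_eq_sq_of_weight_eq_six hv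
  refine ncard_eq_of_legendreSym h3 (fun v hv => ⟨v.1 0, ?_⟩) (fun r hr => ?_) rfl
  · obtain ⟨h1, h2⟩ := key v hv
    push_cast
    linear_combination sum_sq_unitSphere v + 2 * h1 + h2
  · push_cast at hr h3
    have hr0 : r ≠ 0 := by rintro rfl; simp at hr
    refine ncard_image_orbitClass_eq_one (v₀ := spherePoint r r r (by linear_combination hr)) ?_ ?_
    · rw [mem_stabilizerOrder hp]
      simp [spherePoint, zeroWeight, coincidences, hr0]
    · intro v hv
      obtain ⟨h1, h2⟩ := key v hv
      have hs := sum_sq_unitSphere v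
      have h0 : v.1 0 ^ 2 = r ^ 2 := by
        apply mul_left_cancel₀ h3
        linear_combination hs - hr + 2 * h1 + h2
      refine mem_orbit_of_sq_eq 1 fun j => ?_
      fin_cases j <;> simp [spherePoint, h0, ← h1, ← h2]

/-- One coordinate vanishes and the other two have the same square `r²` with `2r² = 1`; up to signed
permutation this is `(r, r, 0)`. -/
lemma ncard_orbits_stabilizerOrder_four (hp : p ≠ 2) :
    ((orbitClass p '' stabilizerOrder p 4).ncard : ℚ) = (1 + (legendreSym p 2 : ℚ)) / 2 := by
  have h2 := two_ne_zero_zmod hp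
  have key : ∀ v ∈ stabilizerOrder p 4, (v.1 2 = 0 ∧ v.1 0 ^ 2 = v.1 1 ^ 2) ∨
      (v.1 1 = 0 ∧ v.1 0 ^ 2 = v.1 2 ^ 2) ∨ (v.1 0 = 0 ∧ v.1 1 ^ 2 = v.1 2 ^ 2) := by
    intro v hv
    rw [mem_stabilizerOrder hp] at hv
    exact eq_zero_of_weight_eq_four hv
  refine ncard_eq_of_legendreSym (by exact_mod_cast h2) (fun v hv => ?_) (fun r hr => ?_) rfl
  · have hs := sum_sq_unitSphere v
    push_cast
    rcases key v hv with ⟨h1, h3⟩ | ⟨h1, h3⟩ | ⟨h1, h3⟩ <;> rw [h1] at hs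
    · exact ⟨v.1 0, by linear_combination hs + h3⟩
    · exact ⟨v.1 0, by linear_combination hs + h3⟩
    · exact ⟨v.1 1, by linear_combination hs + h3⟩
  · push_cast at hr
    have hr0 : r ≠ 0 := by rintro rfl; simp at hr
    refine ncard_image_orbitClass_eq_one (v₀ := spherePoint r r 0 (by linear_combination hr)) ?_ ?_
    · rw [mem_stabilizerOrder hp]
      simp [spherePoint, zeroWeight, coincidences, hr0]
    · intro v hv
      have hs := sum_sq_unitSphere v
      rcases key v hv with ⟨h1, h3⟩ | ⟨h1, h3⟩ | ⟨h1, h3⟩ <;> rw [h1] at hs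
      · have h0 : v.1 0 ^ 2 = r ^ 2 := mul_left_cancel₀ h2 (by linear_combination hs - hr + h3)
        refine mem_orbit_of_sq_eq 1 fun j => ?_
        fin_cases j <;> simp [spherePoint, h0, ← h3, h1]
      · have h0 : v.1 0 ^ 2 = r ^ 2 := mul_left_cancel₀ h2 (by linear_combination hs - hr + h3)
        refine mem_orbit_of_sq_eq (Equiv.swap 1 2) fun j => ?_
        fin_cases j <;> simp [spherePoint, h0, ← h3, h1, Equiv.swap_apply_of_ne_of_ne]
      · have h0 : v.1 1 ^ 2 = r ^ 2 := mul_left_cancel₀ h2 (by linear_combination hs - hr + h3)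
        refine mem_orbit_of_sq_eq (Equiv.swap 0 2) fun j => ?_
        fin_cases j <;> simp [spherePoint, h0, ← h3, h1, Equiv.swap_apply_of_ne_of_ne]

end

section

/-! ### Burnside's formula -/

/-- Burnside's lemma with the pairs `g • x = x` grouped by the point instead of the group element.
-/
theorem sum_card_stabilizer {G X : Type*} [Group G] [Finite G] [MulAction G X] [Fintype X] :
    ∑ x : X, Nat.card (MulAction.stabilizer G x) =
      Nat.card (MulAction.orbitRel.Quotient G X) * Nat.card G := by
  rw [← Nat.card_prod, ← Nat.card_congr (MulAction.sigmaFixedByEquivOrbitsProdGroup G X),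
    ← Nat.card_sigma]
  exact Nat.card_congr
    { toFun := fun x => ⟨x.2.1, x.1, x.2.2⟩
      invFun := fun x => ⟨x.2.1, x.1, x.2.2⟩
      left_inv := fun _ => rfl
      right_inv := fun _ => rfl }

/-! ### Character sums -/

section

variable {F : Type*} [Field F] [Fintype F] [DecidableEq F]

/-- The number of square roots of `u`, counted with the weight `zeroWeight`. -/
def rootWeight (u : F) : ℤ := 1 + quadraticChar F u + if u = 0 then 1 else 0

/-- Stabilizer orders depend on a coordinate only through its square and whether it vanishes, so
sums over coordinates become sums over squares. -/
lemma sum_zeroWeight_mul_sq (hF : ringChar F ≠ 2) (h : F → ℤ) :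
    ∑ x : F, (zeroWeight x : ℤ) * h (x ^ 2) = ∑ u : F, rootWeight u * h u := by
  rw [← Finset.sum_fiberwise_of_maps_to (g := fun x : F => x ^ 2) fun _ _ => Finset.mem_univ _]
  refine Finset.sum_congr rfl fun u _ => ?_
  have h1 : ∑ x ∈ Finset.univ.filter (fun x : F => x ^ 2 = u), (zeroWeight x : ℤ) * h (x ^ 2) =
      (∑ x ∈ Finset.univ.filter (fun x : F => x ^ 2 = u), (zeroWeight x : ℤ)) * h u := by
    rw [Finset.sum_mul]
    exact Finset.sum_congr rfl fun x hx => by rw [(Finset.mem_filter.1 hx).2]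
  have h2 : ∀ x : F, (zeroWeight x : ℤ) = 1 + if x = 0 then 1 else 0 := by
    intro x
    by_cases hx : x = 0 <;> simp [zeroWeight, hx]
  rw [h1]
  congr 1
  simp only [h2]
  rw [Finset.sum_add_distrib, rootWeight, add_comm (1 : ℤ), ← quadraticChar_card_sqrts hF]
  congr 1
  · rw [Finset.sum_const, nsmul_eq_mul, mul_one]
    congr 2
    ext x; simp
  · rw [Finset.sum_ite_eq']
    simp [eq_comm]

lemma quadraticChar_mul_self {a : F} (ha : a ≠ 0) : quadraticChar F a * quadraticChar F a = 1 := by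
  rw [← sq, quadraticChar_sq_one ha]

lemma sum_quadraticChar_mul_one_sub (hF : ringChar F ≠ 2) :
    ∑ u : F, quadraticChar F u * quadraticChar F (1 - u) = -quadraticChar F (-1) := by
  have h := jacobiSum_nontrivial_inv (quadraticChar_ne_one hF)
  rw [(quadraticChar_isQuadratic F).inv] at h
  exact h

omit [DecidableEq F] in
lemma sum_comp_mul_left {a : F} (ha : a ≠ 0) (f : F → ℤ) : ∑ u, f (a * u) = ∑ u, f u :=
  Equiv.sum_comp (Equiv.mulLeft₀ a ha) f

omit [DecidableEq F] in
lemma sum_comp_sub_left (a : F) (f : F → ℤ) : ∑ u, f (a - u) = ∑ u, f u :=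
  Equiv.sum_comp (Equiv.subLeft a) f

/-- For `c ≠ 0` the substitution `u ↦ c u` reduces to the Jacobi sum at `c = 1`; for `c = 0` every
nonzero `u` contributes the character at `-1`. -/
lemma sum_quadraticChar_mul_sub (hF : ringChar F ≠ 2) (c : F) :
    ∑ u : F, quadraticChar F u * quadraticChar F (c - u) =
      quadraticChar F (-1) * ((if c = 0 then (Fintype.card F : ℤ) else 0) - 1) := by
  by_cases hc : c = 0
  · subst hc
    have h1 : ∀ u : F, quadraticChar F u * quadraticChar F (0 - u) =
        quadraticChar F (-1) * (1 - if u = 0 then 1 else 0) := by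
      intro u
      by_cases hu : u = 0
      · simp [hu]
      · rw [zero_sub, neg_eq_neg_one_mul, map_mul, mul_left_comm, quadraticChar_mul_self hu]
        simp [hu]
    simp only [h1, ← Finset.mul_sum, Finset.sum_sub_distrib]
    simp
  · rw [← sum_comp_mul_left hc]
    have h1 : ∀ u : F, quadraticChar F (c * u) * quadraticChar F (c - c * u) =
        quadraticChar F u * quadraticChar F (1 - u) := by
      intro u
      rw [show c - c * u = c * (1 - u) by ring, map_mul, map_mul]
      linear_combination (quadraticChar F u * quadraticChar F (1 - u)) * quadraticChar_mul_self hc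
    simp only [h1, sum_quadraticChar_mul_one_sub hF, if_neg hc]
    ring

lemma sum_rootWeight_mul (h : F → ℤ) :
    ∑ u : F, rootWeight u * h u = ∑ u : F, (1 + quadraticChar F u) * h u + h 0 := by
  simp only [rootWeight, add_mul _ (ite _ _ _), Finset.sum_add_distrib]
  simp

/-- Since one plus the character at `u` counts the square roots of `u`, this is the number of
solutions of `x² + y² = c`. -/
lemma sum_one_add_quadraticChar_mul_sub (hF : ringChar F ≠ 2) (c : F) :
    ∑ u : F, (1 + quadraticChar F u) * (1 + quadraticChar F (c - u)) =
      Fintype.card F +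
        quadraticChar F (-1) * ((if c = 0 then (Fintype.card F : ℤ) else 0) - 1) := by
  rw [← sum_quadraticChar_mul_sub hF]
  have h1 : ∑ u : F, quadraticChar F (c - u) = 0 := by
    rw [sum_comp_sub_left c fun u => quadraticChar F u, quadraticChar_sum_zero hF]
  simp only [add_mul, mul_add, one_mul, mul_one, Finset.sum_add_distrib, h1,
    quadraticChar_sum_zero hF]
  simp

lemma sum_rootWeight_mul_rootWeight_sub (hF : ringChar F ≠ 2) (c : F) :
    ∑ u : F, rootWeight u * rootWeight (c - u) =
      Fintype.card F + quadraticChar F (-1) * ((if c = 0 then (Fintype.card F : ℤ) else 0) - 1) +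
        2 * (1 + quadraticChar F c) + if c = 0 then 1 else 0 := by
  rw [sum_rootWeight_mul, ← sum_one_add_quadraticChar_mul_sub hF]
  have h1 : ∑ u : F, (1 + quadraticChar F u) * rootWeight (c - u) =
      ∑ u : F, (1 + quadraticChar F u) * (1 + quadraticChar F (c - u)) +
        (1 + quadraticChar F c) := by
    simp only [rootWeight, mul_add (1 + quadraticChar F _) (1 + quadraticChar F _) (ite _ _ _),
      Finset.sum_add_distrib]
    congr 1
    simp [sub_eq_zero]
  rw [h1, rootWeight, sub_zero]
  ring

/-- The weighted number of representations of `1` as a sum of three squares. -/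
lemma sum_rootWeight_three (hF : ringChar F ≠ 2) :
    ∑ u : F, rootWeight u * ∑ v : F, rootWeight v * rootWeight (1 - u - v) =
      (Fintype.card F : ℤ) ^ 2 + Fintype.card F * quadraticChar F (-1) +
        3 * (Fintype.card F - quadraticChar F (-1)) + 6 := by
  simp only [sum_rootWeight_mul_rootWeight_sub hF]
  rw [sum_rootWeight_mul]
  have hne : ¬ (1 - 0 : F) = 0 := by simp
  have h1 : ∀ u : F, (1 - u = 0) ↔ u = 1 := fun u => by rw [sub_eq_zero, eq_comm]
  have h2 : ∀ u : F, (1 + quadraticChar F u) * ((Fintype.card F : ℤ) +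
      quadraticChar F (-1) * ((if 1 - u = 0 then (Fintype.card F : ℤ) else 0) - 1) +
        2 * (1 + quadraticChar F (1 - u)) + if 1 - u = 0 then 1 else 0) =
      (1 + quadraticChar F u) * ((Fintype.card F : ℤ) - quadraticChar F (-1)) +
      2 * ((1 + quadraticChar F u) * (1 + quadraticChar F (1 - u))) +
      if u = 1 then 2 * (quadraticChar F (-1) * Fintype.card F + 1) else 0 := by
    intro u
    by_cases hu : u = 1
    · simp [hu]; ring
    · simp [h1, hu]; ring
  simp only [h2, Finset.sum_add_distrib, ← Finset.mul_sum, ← Finset.sum_mul,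
    sum_one_add_quadraticChar_mul_sub hF, quadraticChar_sum_zero hF]
  simp
  ring

/-- The weighted number of representations of `1` with the first two squares equal. -/
lemma sum_rootWeight_two (hF : ringChar F ≠ 2) (h2 : (2 : F) ≠ 0) :
    ∑ u : F, rootWeight u * (rootWeight u * rootWeight (1 - 2 * u)) =
      2 * (Fintype.card F - quadraticChar F (-2) + 3 + quadraticChar F 2) := by
  -- `rootWeight` takes only the values 2, on squares including 0, and 0, on nonsquares.
  have hsq : ∀ u : F, rootWeight u * rootWeight u = 2 * rootWeight u := by
    intro u
    by_cases hu : u = 0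
    · simp [rootWeight, hu]
    · have := quadraticChar_mul_self hu
      simp only [rootWeight, hu, if_false]
      linear_combination this
  have h1 : ∀ u : F, rootWeight u * (rootWeight u * rootWeight (1 - 2 * u)) =
      2 * (rootWeight u * rootWeight (1 - 2 * u)) := fun u => by
    linear_combination rootWeight (1 - 2 * u) * hsq u
  simp only [h1, ← Finset.mul_sum]
  congr 1
  have hq2 := quadraticChar_mul_self h2
  have h3 : ∑ u : F, quadraticChar F u * quadraticChar F (1 - 2 * u) = -quadraticChar F (-2) := by
    have h4 := sum_quadraticChar_mul_one_sub hF
    rw [← sum_comp_mul_left h2] at h4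
    have h5 : ∀ u : F, quadraticChar F u * quadraticChar F (1 - 2 * u) =
        quadraticChar F 2 * (quadraticChar F (2 * u) * quadraticChar F (1 - 2 * u)) := by
      intro u
      rw [map_mul]
      linear_combination -(quadraticChar F u * quadraticChar F (1 - 2 * u)) * hq2
    simp only [h5, ← Finset.mul_sum, h4]
    rw [show (-2 : F) = 2 * -1 by ring, map_mul]
    ring
  have h6 : ∑ u : F, quadraticChar F (1 - 2 * u) = 0 := by
    rw [sum_comp_mul_left h2 fun u => quadraticChar F (1 - u),
      sum_comp_sub_left 1 fun u => quadraticChar F u, quadraticChar_sum_zero hF]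
  have h7 : ∀ u : F, (1 - 2 * u = 0) ↔ u = 2⁻¹ := fun u => by
    rw [sub_eq_zero, eq_comm, mul_comm, ← eq_div_iff h2, one_div]
  have h8 : quadraticChar F (2⁻¹) = quadraticChar F 2 := by
    have : quadraticChar F 2 * quadraticChar F (2⁻¹) = 1 := by
      rw [← map_mul, mul_inv_cancel₀ h2, map_one]
    linear_combination quadraticChar F 2 * this - quadraticChar F (2⁻¹) * hq2
  rw [sum_rootWeight_mul]
  have h9 : ∀ u : F, (1 + quadraticChar F u) * rootWeight (1 - 2 * u) =
      1 + quadraticChar F u + quadraticChar F (1 - 2 * u) +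
        quadraticChar F u * quadraticChar F (1 - 2 * u) +
        if u = 2⁻¹ then 1 + quadraticChar F 2 else 0 := by
    intro u
    by_cases hu : u = 2⁻¹
    · rw [rootWeight, if_pos ((h7 u).2 hu), if_pos hu, hu, h8]; ring
    · rw [rootWeight, if_neg fun h => hu ((h7 u).1 h), if_neg hu]; ring
  simp only [h9, Finset.sum_add_distrib, h3, h6, quadraticChar_sum_zero hF]
  simp [rootWeight]
  ring

/-- The cube of `1 ± 1` is four times `1 ± 1`. This is the contribution of the points whose squares
are all `1/3`. -/
lemma rootWeight_inv_three (h3 : (3 : F) ≠ 0) :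
    rootWeight (3⁻¹ : F) * (rootWeight (3⁻¹ : F) * rootWeight (3⁻¹ : F)) =
      4 * (1 + quadraticChar F 3) := by
  have hq : quadraticChar F (3⁻¹) = quadraticChar F 3 := by
    have h1 : quadraticChar F 3 * quadraticChar F (3⁻¹) = 1 := by
      rw [← map_mul, mul_inv_cancel₀ h3, map_one]
    have h2 := quadraticChar_mul_self h3
    linear_combination quadraticChar F 3 * h1 - quadraticChar F (3⁻¹) * h2
  have h2 := quadraticChar_mul_self h3
  simp only [rootWeight, inv_eq_zero, h3, if_false, hq]
  linear_combination (quadraticChar F 3 + 3) * h2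

end

end

/-! ### Counting all orbits on the unit sphere. -/

section

section

variable {F : Type*} [Field F] [Fintype F] [DecidableEq F]

/-- Each coordinate is replaced by its square in turn, and the equation of the sphere eliminates the
third square. The nested products let `sum_zeroWeight_mul_sq` act on one variable at a time. -/
lemma sum_sphere_eq (hF : ringChar F ≠ 2) (g : F → F → F → ℤ) :
    ∑ v : Fin 3 → F, (zeroWeight (v 0) : ℤ) * (zeroWeight (v 1) * (zeroWeight (v 2) *
      if v 0 ^ 2 + v 1 ^ 2 + v 2 ^ 2 = 1 then g (v 0 ^ 2) (v 1 ^ 2) (v 2 ^ 2) else 0)) =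
    ∑ u : F, rootWeight u * ∑ v : F, rootWeight v *
      (rootWeight (1 - u - v) * g u v (1 - u - v)) := by
  let E : (Fin 3 → F) ≃ F × F × F :=
    { toFun := fun v => (v 0, v 1, v 2)
      invFun := fun t => ![t.1, t.2.1, t.2.2]
      left_inv := fun v => by ext i; fin_cases i <;> rfl
      right_inv := fun _ => rfl }
  have h1 := Equiv.sum_comp E fun t => (zeroWeight t.1 : ℤ) * (zeroWeight t.2.1 *
    (zeroWeight t.2.2 * if t.1 ^ 2 + t.2.1 ^ 2 + t.2.2 ^ 2 = 1 then
      g (t.1 ^ 2) (t.2.1 ^ 2) (t.2.2 ^ 2) else 0))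
  refine h1.trans ?_
  simp only [Fintype.sum_prod_type, ← Finset.mul_sum]
  have h2 : ∀ u v : F, ∑ z : F, (zeroWeight z : ℤ) *
      (if u + v + z ^ 2 = 1 then g u v (z ^ 2) else 0) =
      rootWeight (1 - u - v) * g u v (1 - u - v) := by
    intro u v
    rw [sum_zeroWeight_mul_sq hF fun w => if u + v + w = 1 then g u v w else 0]
    rw [Finset.sum_eq_single (1 - u - v)]
    · rw [if_pos (by ring)]
    · intro w _ hw
      rw [if_neg fun h => hw (by linear_combination h), mul_zero]
    · simp
  simp only [h2]
  have h3 : ∀ u : F, ∑ y : F, (zeroWeight y : ℤ) *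
      (rootWeight (1 - u - y ^ 2) * g u (y ^ 2) (1 - u - y ^ 2)) =
      ∑ v : F, rootWeight v * (rootWeight (1 - u - v) * g u v (1 - u - v)) := fun u =>
    sum_zeroWeight_mul_sq hF fun v => rootWeight (1 - u - v) * g u v (1 - u - v)
  simp only [h3]
  exact sum_zeroWeight_mul_sq hF fun u =>
    ∑ v : F, rootWeight v * (rootWeight (1 - u - v) * g u v (1 - u - v))

/-- Expanding `coincidences` gives the full sphere sum, three equal sums over the loci where two
squares agree, and twice the term at `u = v = 1/3`. The constants add up as `6 + 18 + 8 = 32`. -/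
lemma sum_rootWeight_coincidences (hF : ringChar F ≠ 2) (h2 : (2 : F) ≠ 0) (h3 : (3 : F) ≠ 0) :
    ∑ u : F, rootWeight u * ∑ v : F, rootWeight v *
      (rootWeight (1 - u - v) * (coincidences u v (1 - u - v) : ℤ)) =
    (Fintype.card F : ℤ) ^ 2 + Fintype.card F * (9 + quadraticChar F (-1))
      - 3 * quadraticChar F (-1) + 6 * quadraticChar F 2 - 6 * quadraticChar F (-2)
      + 8 * quadraticChar F 3 + 32 := by
  have key : ∀ u v : F, rootWeight u * (rootWeight v *
      (rootWeight (1 - u - v) * (coincidences u v (1 - u - v) : ℤ))) =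
      rootWeight u * (rootWeight v * rootWeight (1 - u - v)) +
      (if u = v then rootWeight u * (rootWeight u * rootWeight (1 - 2 * u)) else 0) +
      (if v = 1 - 2 * u then rootWeight u * (rootWeight u * rootWeight (1 - 2 * u)) else 0) +
      (if u = 1 - 2 * v then rootWeight v * (rootWeight v * rootWeight (1 - 2 * v)) else 0) +
      2 * (if u = 3⁻¹ then if v = 3⁻¹ then
        rootWeight (3⁻¹ : F) * (rootWeight (3⁻¹ : F) * rootWeight (3⁻¹ : F)) else 0 else 0) := by
    intro u v
    -- Each coincidence with the third square is solved for one variable, so that a sum over that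
    -- variable collapses.
    have e1 : u = 1 - u - v ↔ v = 1 - 2 * u :=
      ⟨fun h => by linear_combination h, fun h => by linear_combination h⟩
    have e2 : v = 1 - u - v ↔ u = 1 - 2 * v :=
      ⟨fun h => by linear_combination h, fun h => by linear_combination h⟩
    have t0 : (coincidences u v (1 - u - v) : ℤ) = 1 + (if u = v then 1 else 0) +
        (if v = 1 - 2 * u then 1 else 0) + (if u = 1 - 2 * v then 1 else 0) +
        2 * (if u = 3⁻¹ then if v = 3⁻¹ then 1 else 0 else 0) := by
      have e3 : (u = v ∧ v = 1 - u - v) ↔ (u = 3⁻¹ ∧ v = 3⁻¹) := by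
        constructor
        · rintro ⟨rfl, h⟩
          have : u = 3⁻¹ := eq_inv_of_mul_eq_one_left (by linear_combination h)
          exact ⟨this, this⟩
        · rintro ⟨rfl, rfl⟩
          refine ⟨rfl, ?_⟩
          field_simp
          ring
      simp only [coincidences, e3]
      simp only [e1, e2, ite_and]
      push_cast
      rfl
    rw [t0]
    have s1 : (if u = v then rootWeight u * (rootWeight u * rootWeight (1 - 2 * u)) else 0) =
        rootWeight u * (rootWeight v * (rootWeight (1 - u - v) * if u = v then 1 else 0)) := by
      split_ifs with h
      · subst h; rw [show 1 - u - u = 1 - 2 * u by ring, mul_one]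
      · ring
    have s2 : (if v = 1 - 2 * u then rootWeight u * (rootWeight u * rootWeight (1 - 2 * u))
        else 0) = rootWeight u * (rootWeight v * (rootWeight (1 - u - v) *
          if v = 1 - 2 * u then 1 else 0)) := by
      split_ifs with h
      · rw [← e1.2 h, ← h]; ring
      · ring
    have s3 : (if u = 1 - 2 * v then rootWeight v * (rootWeight v * rootWeight (1 - 2 * v))
        else 0) = rootWeight u * (rootWeight v * (rootWeight (1 - u - v) *
          if u = 1 - 2 * v then 1 else 0)) := by
      split_ifs with h
      · rw [← e2.2 h, ← h]; ring
      · ring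
    have s4 : (if u = 3⁻¹ then if v = 3⁻¹ then
        rootWeight (3⁻¹ : F) * (rootWeight (3⁻¹ : F) * rootWeight (3⁻¹ : F)) else 0 else 0) =
        rootWeight u * (rootWeight v * (rootWeight (1 - u - v) *
          if u = 3⁻¹ then if v = 3⁻¹ then 1 else 0 else 0)) := by
      split_ifs with h h'
      · rw [h, h', show (1 - 3⁻¹ - 3⁻¹ : F) = 3⁻¹ by field_simp; ring]; ring
      · ring
      · ring
    rw [s1, s2, s3, s4]
    ring
  have h0 : ∑ u : F, ∑ v : F, rootWeight u * (rootWeight v * rootWeight (1 - u - v)) =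
      ∑ u : F, rootWeight u * ∑ v : F, rootWeight v * rootWeight (1 - u - v) :=
    Finset.sum_congr rfl fun u _ => (Finset.mul_sum _ _ _).symm
  have h4 : ∑ u : F, ∑ v : F,
      (if u = 1 - 2 * v then rootWeight v * (rootWeight v * rootWeight (1 - 2 * v)) else 0) =
      ∑ u : F, rootWeight u * (rootWeight u * rootWeight (1 - 2 * u)) := by
    rw [Finset.sum_comm]
    simp
  simp only [Finset.mul_sum, key, Finset.sum_add_distrib]
  rw [h0, h4, sum_rootWeight_three hF]
  simp only [← Finset.mul_sum, Finset.sum_ite_eq, Finset.sum_ite_eq', Finset.mem_univ, if_true,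
    sum_rootWeight_two hF h2]
  have h5 : ∑ u : F, ∑ v : F, (if u = 3⁻¹ then if v = 3⁻¹ then
      rootWeight (3⁻¹ : F) * (rootWeight (3⁻¹ : F) * rootWeight (3⁻¹ : F)) else 0 else 0) =
      rootWeight (3⁻¹ : F) * (rootWeight (3⁻¹ : F) * rootWeight (3⁻¹ : F)) := by
    rw [Finset.sum_eq_single (3⁻¹ : F)]
    · simp
    · intro u _ hu; simp [hu]
    · simp
  rw [h5, rootWeight_inv_three h3]
  ring

end

/-- Burnside's formula for a group of order 48; `p > 3` makes 2 and 3 invertible in the character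
sums. -/
theorem card_orbits_unitSphere {p : ℕ} [Fact p.Prime] (hp : 3 < p) :
    48 * (Nat.card (MulAction.orbitRel.Quotient (orthogonalGroup (Fin 3) ℤ) (UnitSphere p)) : ℤ) =
      (p : ℤ) ^ 2 + p * (9 + legendreSym p (-1)) - 3 * legendreSym p (-1)
      + 6 * legendreSym p 2 - 6 * legendreSym p (-2) + 8 * legendreSym p 3 + 32 := by
  have hp2 : p ≠ 2 := by omega
  have h2 := two_ne_zero_zmod hp2
  have h3 : (3 : ZMod p) ≠ 0 := by
    intro h
    have h4 : ((3 : ℕ) : ZMod p) = 0 := by exact_mod_cast h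
    rw [ZMod.natCast_eq_zero_iff] at h4
    exact absurd (Nat.le_of_dvd (by norm_num) h4) (by omega)
  have hF : ringChar (ZMod p) ≠ 2 := by rwa [ZMod.ringChar_zmod_n]
  have h1 := sum_card_stabilizer (G := orthogonalGroup (Fin 3) ℤ) (X := UnitSphere p)
  rw [card_orthogonalGroup] at h1
  have h4 : ((∑ v : UnitSphere p,
      Nat.card (MulAction.stabilizer (orthogonalGroup (Fin 3) ℤ) v) : ℕ) : ℤ) =
      ∑ v : Fin 3 → ZMod p, (zeroWeight (v 0) : ℤ) * (zeroWeight (v 1) * (zeroWeight (v 2) *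
        if v 0 ^ 2 + v 1 ^ 2 + v 2 ^ 2 = 1 then
          (coincidences (v 0 ^ 2) (v 1 ^ 2) (v 2 ^ 2) : ℤ) else 0)) := by
    have hdot : ∀ v : Fin 3 → ZMod p, v ⬝ᵥ v = 1 ↔ v 0 ^ 2 + v 1 ^ 2 + v 2 ^ 2 = 1 := by
      intro v
      simp only [dotProduct, Fin.sum_univ_three, sq]
    push_cast
    simp only [card_stabilizer hp2]
    rw [← Finset.sum_subtype (Finset.univ.filter fun v : Fin 3 → ZMod p => v ⬝ᵥ v = 1)
      (fun v => by simp) fun v => ((zeroWeight (v 0) * zeroWeight (v 1) * zeroWeight (v 2) *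
        coincidences (v 0 ^ 2) (v 1 ^ 2) (v 2 ^ 2) : ℕ) : ℤ), Finset.sum_filter]
    refine Finset.sum_congr rfl fun v _ => ?_
    simp only [hdot]
    split_ifs
    · push_cast; ring
    · ring
  rw [sum_sphere_eq hF fun u v w => (coincidences u v w : ℤ),
    sum_rootWeight_coincidences hF h2 h3, ZMod.card] at h4
  simp only [legendreSym, Int.cast_neg, Int.cast_one, Int.cast_ofNat]
  rw [← h4, h1]
  push_cast
  ring

end

end TernaryLattice

theorem mainTheorem6 (p : ℕ) [Fact p.Prime] (hp : 3 < p)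
    {V : Type*} [AddCommGroup V] [Module ℚ V] (hV : finrank ℚ V = 3)
    (B : LinearMap.BilinForm ℚ V) (hsymm : B.IsSymm) (hpos : ∀ x : V, x ≠ 0 → 0 < B x x)
    (L : Submodule ℤ V) (hL : L.IsLattice ℚ) (hprim : TernaryLattice.IsPrimitive B L)
    (hdisc : TernaryLattice.HasDiscriminant B L ((p : ℚ) ^ 2))
    (hloc : TernaryLattice.HasGram (B.baseChange ℚ_[p]) (TernaryLattice.completion p L)
      (Matrix.diagonal ![1, 1, (p : ℚ_[p]) ^ 2])) :
    TernaryLattice.HasGram B (TernaryLattice.watson B p L)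
      (Matrix.diagonal ![(p : ℚ) ^ 2, (p : ℚ) ^ 2, (p : ℚ) ^ 2]) ∧
    TernaryLattice.classNumber B (TernaryLattice.watson B p L) = 1 ∧
    TernaryLattice.fiberClasses B p L (TernaryLattice.watson B p L) 16 = 1 ∧
    (TernaryLattice.fiberClasses B p L (TernaryLattice.watson B p L) 12 : ℚ) =
      (1 + (legendreSym p 3 : ℚ)) / 2 ∧
    (TernaryLattice.fiberClasses B p L (TernaryLattice.watson B p L) 8 : ℚ) =
      (1 + (legendreSym p 2 : ℚ)) / 2 ∧
    (TernaryLattice.classNumber B L : ℚ) =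
      1 / 48 * ((p : ℚ) ^ 2 + (p : ℚ) * (9 + (legendreSym p (-1) : ℚ))
        - 3 * (legendreSym p (-1) : ℚ) + 6 * (legendreSym p 2 : ℚ)
        - 6 * (legendreSym p (-2) : ℚ) + 8 * (legendreSym p 3 : ℚ) + 32) := by
  have hp2 : p ≠ 2 := by omega
  obtain ⟨e, he, v₀, hv₀, hLe⟩ := TernaryLattice.exists_eq_congruenceSublattice_of_mem_genus hV
    hsymm hpos hL hprim hdisc hloc (TernaryLattice.self_mem_genus B L hL)
  have hN := TernaryLattice.watson_congruenceSublattice hp2 he hv₀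
  rw [← hLe] at hN
  have hfib := fun n => TernaryLattice.fiberClasses_eq_ncard_orbits hp2 hV hsymm hpos hL hprim hdisc
    hloc he hv₀ hLe n
  -- Isometry groups of order 16, 12 and 8 correspond to stabilizers of order 8, 6 and 4.
  have hstab : ∀ n, {v : TernaryLattice.UnitSphere p | 2 * Nat.card (MulAction.stabilizer
      (Matrix.orthogonalGroup (Fin 3) ℤ) v) = 2 * n} = TernaryLattice.stabilizerOrder p n :=
    fun n => Set.ext fun v => mul_right_inj' two_ne_zero
  have h3 : ((3 : ℤ) : ZMod p) ≠ 0 := by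
    intro h
    rw [ZMod.intCast_zmod_eq_zero_iff_dvd] at h
    exact absurd (Int.le_of_dvd (by norm_num) h) (by omega)
  refine ⟨?_, ?_, ?_, ?_, ?_, ?_⟩
  · have hgram := TernaryLattice.hasGram_span B
      (TernaryLattice.scaledBasis (TernaryLattice.primeUnit p) e)
    rw [← hN, TernaryLattice.gram_scaledBasis, he] at hgram
    convert hgram using 1
    ext i j
    fin_cases i <;> fin_cases j <;> simp [TernaryLattice.primeUnit]
  · rw [hN]
    exact TernaryLattice.classNumber_span_scaledBasis hsymm hpos _ he
  · rw [hfib 16, hstab 8, TernaryLattice.ncard_orbits_stabilizerOrder_eight hp2]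
  · rw [hfib 12, hstab 6, TernaryLattice.ncard_orbits_stabilizerOrder_six hp2 h3]
  · rw [hfib 8, hstab 4, TernaryLattice.ncard_orbits_stabilizerOrder_four hp2]
  · have hcl := TernaryLattice.classNumber_eq_ncard_orbits hp2 hV hsymm hpos hL hprim hdisc hloc he
      hv₀ hLe
    rw [Set.image_univ, Set.range_eq_univ.2 Quotient.mk_surjective, Set.ncard_univ] at hcl
    have hcard := congrArg (Int.cast : ℤ → ℚ) (TernaryLattice.card_orbits_unitSphere hp)
    push_cast at hcard
    rw [hcl, ← hcard]
    ring
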